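/- Let $\mathbb{T}^2=\mathbb{R}^2/\mathbb{Z}^2$ be the $2$-torus with its normalized Haar measure $\nu$, on which $GL(2,\mathbb{Z})\simeq\mathrm{Aut}(\mathbb{T}^2)$ acts by automorphisms $x\mapsto\gamma x$. Let $\Gamma\le GL(2,\mathbb{Z})$ be a free subgroup of rank $r\ge 1$, freely generated by $a_1,\dots,a_r$. Put $S=\{a_1^{\pm1},\dots,a_r^{\pm1}\}$ and $q=2r-1$. For an integer $n\ge 0$ let $S_n$, respectively $B_n$, be the sphere, respectively the ball, of radius $n$ around the identity of $\Gamma$ for the word metric defined by $S$. For a finite symmetric set $E=E^{-1}\subset\Gamma$, the discrepancy of $E$ is the operator norm of $\frac1{|E|}\sum_{\gamma\in E}\pi_0(\gamma)$ on $L^2_0(\mathbb{T}^2,\nu)=\{f\in L^2(\mathbb{T}^2,\nu):\int f\,d\nu=0\}$ (complex-valued functions), where $\pi_0(\gamma)f(x)=f(\gamma^{-1}x)$. Then the discrepancy of $S_n$ and the supremum $$\sup_{\|f\|_2=1}\left\|\frac1{|S_n|}\sum_{\gamma\in S_n}f(\gamma x)-\int_{\mathbb{T}^2}f(y)\,d\nu(y)\right\|_2$$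 are both equal to $$\left(1+\frac{q-1}{q+1}\,n\right)q^{-n/2},$$ and the discrepancy of $B_n$ and the supremum $$\sup_{\|f\|_2=1}\left\|\frac1{|B_n|}\sum_{\gamma\in B_n}f(\gamma x)-\int_{\mathbb{T}^2}f(y)\,d\nu(y)\right\|_2$$ are both equal to $$c(q,n)\left(1+\left(1+\frac1{\sqrt q}\right)n\right)q^{-n/2},\qquad c(q,n)=\left(1+2q^{-n}\sum_{k=0}^{n-1}q^k\right)^{-1}.$$ Here $f$ runs over the unit sphere of $L^2(\mathbb{T}^2,\nu)$, and $\|\cdot\|_2$ is the norm of $L^2(\mathbb{T}^2,\nu)$ (of the function of $x$ inside). -/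

import Mathlib

open MeasureTheory
open scoped ENNReal

/-! ### The word metric -/

section WordMetric

variable {G : Type*} [Group G]

/-- The word length of `g` with respect to `S`: the least length of a word in the elements of `S`
whose product is `g` (and `⊤` if there is no such word). -/
noncomputable def wordLength (S : Set G) (g : G) : ℕ∞ :=
  ⨅ (l : List G) (_ : ∀ s ∈ l, s ∈ S) (_ : l.prod = g), (l.length : ℕ∞)

/-- The word metric defined by the symmetric set `S`. -/
noncomputable def wordDist (S : Set G) (g h : G) : ℕ∞ := wordLength S (g⁻¹ * h)

theorem exists_word_of_wordLength_le {S : Set G} {g : G} {n : ℕ} (h : wordLength S g ≤ n) :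
    ∃ l : List G, (∀ s ∈ l, s ∈ S) ∧ l.prod = g ∧ l.length ≤ n := by
  have h' : wordLength S g < ((n + 1 : ℕ) : ℕ∞) :=
    lt_of_le_of_lt h (by exact_mod_cast Nat.lt_succ_self n)
  simp only [wordLength, iInf_lt_iff] at h'
  obtain ⟨l, hl, hp, hlt⟩ := h'
  exact ⟨l, hl, hp, Nat.lt_succ_iff.mp (by exact_mod_cast hlt)⟩

theorem finite_wordDist_le (S : Finset G) (n : ℕ) :
    {g : G | wordDist (S : Set G) 1 g ≤ n}.Finite := by
  have hfin : {l : List (S : Set G) | l.length ≤ n}.Finite := List.finite_length_le _ n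
  refine (hfin.image fun l => (l.map Subtype.val).prod).subset ?_
  intro g hg
  replace hg : wordLength (S : Set G) (1⁻¹ * g) ≤ n := hg
  rw [inv_one, one_mul] at hg
  obtain ⟨l, hl, hp, hn⟩ := exists_word_of_wordLength_le hg
  refine ⟨l.attach.map fun s => ⟨s.1, hl s.1 s.2⟩, ?_, ?_⟩
  · simpa using hn
  · simp [List.map_map, Function.comp_def, hp]

/-- The ball of radius `n` around the identity, for the word metric defined by `S`. -/
noncomputable def wordBall (S : Finset G) (n : ℕ) : Finset G :=
  (finite_wordDist_le S n).toFinset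

/-- The sphere of radius `n` around the identity, for the word metric defined by `S`. -/
noncomputable def wordSphere (S : Finset G) (n : ℕ) : Finset G :=
  ((finite_wordDist_le S n).subset
    (fun _ hg => le_of_eq hg : {g : G | wordDist (S : Set G) 1 g = n} ⊆ _)).toFinset

open scoped Classical in
/-- The symmetric set `{a₁, a₁⁻¹, …, a_r, a_r⁻¹}`. -/
noncomputable def symmGenerators {r : ℕ} (a : Fin r → G) : Finset G :=
  Finset.univ.image a ∪ Finset.univ.image fun i => (a i)⁻¹

end WordMetric

/-! ### The action of `GL(2, ℤ)` on the torus -/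

/-- The torus `𝕋² = (ℝ/ℤ)²`. -/
abbrev Torus2 : Type := UnitAddTorus (Fin 2)

/-- The normalized Haar measure of `𝕋²`, the product of the Haar probability measures of the two
circles. -/
noncomputable abbrev torusHaar : Measure Torus2 :=
  Measure.pi fun _ : Fin 2 => (AddCircle.haarAddCircle : Measure UnitAddCircle)

/-- The automorphism `x ↦ A x` of `𝕋²` given by a matrix `A ∈ GL(2, ℤ)`. -/
noncomputable def torusAut (A : GL (Fin 2) ℤ) : Torus2 →+ Torus2 where
  toFun x i := ∑ j, (A : Matrix (Fin 2) (Fin 2) ℤ) i j • x j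
  map_zero' := by ext i; simp
  map_add' x y := by ext i; simp [Finset.sum_add_distrib]

theorem torusAut_one (x : Torus2) : torusAut 1 x = x := by
  ext i
  simp [torusAut, Matrix.one_apply, ite_smul]

theorem torusAut_mul (A B : GL (Fin 2) ℤ) (x : Torus2) :
    torusAut (A * B) x = torusAut A (torusAut B x) := by
  ext i
  simp only [torusAut, AddMonoidHom.coe_mk, ZeroHom.coe_mk, Units.val_mul, Matrix.mul_apply,
    Finset.sum_smul, Finset.smul_sum, mul_smul]
  exact Finset.sum_comm

theorem continuous_torusAut (A : GL (Fin 2) ℤ) : Continuous (torusAut A) := by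
  change Continuous fun (x : Torus2) (i : Fin 2) =>
    ∑ j, (A : Matrix (Fin 2) (Fin 2) ℤ) i j • x j
  fun_prop

theorem measurePreserving_torusAut (A : GL (Fin 2) ℤ) :
    MeasurePreserving (torusAut A) torusHaar torusHaar :=
  (torusAut A).measurePreserving (continuous_torusAut A)
    (fun y => ⟨torusAut A⁻¹ y, by rw [← torusAut_mul, mul_inv_cancel, torusAut_one]⟩) rfl

/-! ### The Koopman representation and the discrepancy -/

/-- The Koopman representation on `L²(𝕋²)`: `(π(A) f)(x) = f(A⁻¹ x)`. -/
noncomputable def koopman (A : GL (Fin 2) ℤ) : Lp ℂ 2 torusHaar →L[ℂ] Lp ℂ 2 torusHaar :=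
  (Lp.compMeasurePreservingₗᵢ ℂ (torusAut A⁻¹)
    (measurePreserving_torusAut A⁻¹)).toContinuousLinearMap

theorem integrable_torusL2 (f : Lp ℂ 2 torusHaar) : Integrable f torusHaar :=
  (Lp.memLp f).integrable (by norm_num)

/-- The space `L²₀(𝕋²)` of the functions in `L²(𝕋²)` with zero integral. -/
noncomputable def torusL20 : Submodule ℂ (Lp ℂ 2 torusHaar) where
  carrier := {f | ∫ x, f x ∂torusHaar = 0}
  zero_mem' := by
    change ∫ x, (0 : Lp ℂ 2 torusHaar) x ∂torusHaar = 0
    rw [integral_congr_ae (Lp.coeFn_zero ℂ 2 torusHaar)]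
    simp
  add_mem' := by
    intro f g hf hg
    change ∫ x, (f + g : Lp ℂ 2 torusHaar) x ∂torusHaar = 0
    rw [integral_congr_ae (Lp.coeFn_add f g)]
    simp only [Pi.add_apply]
    rw [integral_add (integrable_torusL2 f) (integrable_torusL2 g), hf, hg, add_zero]
  smul_mem' := by
    intro c f hf
    change ∫ x, (c • f : Lp ℂ 2 torusHaar) x ∂torusHaar = 0
    rw [integral_congr_ae (Lp.coeFn_smul c f)]
    simp only [Pi.smul_apply]
    rw [integral_smul, hf, smul_zero]

theorem koopman_mem_torusL20 (A : GL (Fin 2) ℤ) {f : Lp ℂ 2 torusHaar} (hf : f ∈ torusL20) :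
    koopman A f ∈ torusL20 := by
  have hA := measurePreserving_torusAut A⁻¹
  change ∫ x, (Lp.compMeasurePreserving (torusAut A⁻¹) hA f) x ∂torusHaar = 0
  rw [integral_congr_ae (Lp.coeFn_compMeasurePreserving f hA)]
  have h := integral_map (μ := torusHaar) (φ := torusAut A⁻¹) hA.aemeasurable (f := f)
    (by rw [hA.map_eq]; exact (Lp.memLp f).1)
  rw [hA.map_eq] at h
  exact h.symm.trans hf

/-- The restriction `π₀(A)` of `π(A)` to `L²₀(𝕋²)`. -/
noncomputable def koopmanZero (A : GL (Fin 2) ℤ) : torusL20 →L[ℂ] torusL20 :=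
  ((koopman A).comp torusL20.subtypeL).codRestrict torusL20
    fun f => koopman_mem_torusL20 A f.2

/-- The discrepancy of a finite set `E` of elements of `Γ ≤ GL(2, ℤ)`: the operator norm on
`L²₀(𝕋²)` of `π₀(μ_E)`, where `μ_E` is the uniform probability on `E`. -/
noncomputable def discrepancy {Γ : Subgroup (GL (Fin 2) ℤ)} (E : Finset Γ) : ℝ :=
  ‖(E.card : ℂ)⁻¹ • ∑ γ ∈ E, koopmanZero (γ : GL (Fin 2) ℤ)‖

/-- The supremum over the unit sphere of `L²(𝕋²)` of the `L²`-distance between the mean of `f`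
along `E` and the integral of `f`. -/
noncomputable def meanErgodicError {Γ : Subgroup (GL (Fin 2) ℤ)} (E : Finset Γ) : ℝ≥0∞ :=
  ⨆ (f : Torus2 → ℂ) (_ : MemLp f 2 torusHaar) (_ : eLpNorm f 2 torusHaar = 1),
    eLpNorm (fun x => (E.card : ℂ)⁻¹ * ∑ γ ∈ E, f (torusAut (γ : GL (Fin 2) ℤ) x)
      - ∫ y, f y ∂torusHaar) 2 torusHaar

/-- The constant `c(q, n) = (1 + 2 q⁻ⁿ ∑_{k=0}^{n-1} q^k)⁻¹`. -/
noncomputable def ballConstant (q : ℝ) (n : ℕ) : ℝ :=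
  (1 + 2 * (q ^ n)⁻¹ * ∑ k ∈ Finset.range n, q ^ k)⁻¹

/-!
The Fourier transform turns the Koopman representation on `L²₀(𝕋²)` into the permutation
representation of `Γ` on `ℓ²(ℤ² \ {0})`. Let `A n` be the sum of the operators `π₀(γ)` over the
sphere of radius `n`.

*Recursion.* Counting reduced words gives `A 1 * A n = A (n + 1) + q A (n - 1)` for
`n ≥ 2` (`FreeGroupBasis.sum_letter_mul_sphere_succ`), so `A n = P n (A 1)` for the polynomials
`P n = spherePoly q n`, where `P n (2 √q y) = q^{n/2} ((1 - 1/q) U n y + (2/q) T n y)` for `n ≥ 1`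
with the Chebyshev polynomials `T n` and `U n`. In particular `|P n|` is at most `P n (2 √q)` on
`[-2 √q, 2 √q]`.

*Upper bound.* A matrix of `GL(2, ℤ)` with a nonzero fixed vector is unipotent or an involution, and
`Γ` is torsion-free, so the stabilizer in `Γ` of a point of `ℤ² \ {0}` is commutative. Hence it
fixes a vertex or an end of the Cayley tree of `Γ`, and every edge of the Schreier
graph can be oriented towards that vertex or end (`FreeGroupBasis.exists_orientation`): at most one edge leaves each vertex. The Schur test with
weights `√q` and `1/√q` along and against the orientation gives `‖A 1‖ ≤ 2 √q`
(`FreeGroupBasis.schur_test`, `norm_sphereOp_one_le`), and the functional calculus of the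
self-adjoint operator `A 1` gives `‖∑_{k ∈ I} A k‖ ≤ ∑_{k ∈ I} P k (2 √q)`.

*Lower bound.* For each `N` some character is moved by all `γ ≠ 1` in the ball of radius `2N`, so
that its translates by the ball of radius `N` are distinct, hence orthonormal. For such
a character `e`, the vector `∑_{k ≤ N} q^{-k/2} A k e` is the copy of a radial function on the tree;
it is almost an eigenvector of `A 1` for `2 √q`
(`IsSphereSequence.exists_approximate_eigenvector`), so that `p(2 √q)` is a lower bound of the
norm of `p(A 1)` for each polynomial `p`.

Balls are unions of spheres, and `norm_sum_sphereOp` gives the norms of their sums. The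
mean ergodic error equals the discrepancy because the sets are symmetric and the projection of `L²`
onto `L²₀` is a contraction that commutes with `Γ` (`meanErgodicError_eq_discrepancy`).
-/

/-! ### Reduced words in a free group -/

namespace FreeGroupBasis

variable {ι G : Type*} [Group G] (a : FreeGroupBasis ι G)

/-- The inverse of a letter. -/
def letterInv (x : ι × Bool) : ι × Bool := (x.1, !x.2)

@[simp] theorem letterInv_letterInv (x : ι × Bool) : letterInv (letterInv x) = x := by
  simp [letterInv]

/-- The element of the group given by a letter: `a i` or `(a i)⁻¹`. -/
def letter (x : ι × Bool) : G := a.repr.symm (FreeGroup.mk [x])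

theorem letter_letterInv (x : ι × Bool) : a.letter (letterInv x) = (a.letter x)⁻¹ := by
  rw [letter, letter, ← map_inv, FreeGroup.inv_mk]
  simp [FreeGroup.invRev, letterInv]

@[simp] theorem letterInv_mul_cancel (x : ι × Bool) (g : G) :
    a.letter (letterInv x) * (a.letter x * g) = g := by
  rw [letter_letterInv, inv_mul_cancel_left]

@[simp] theorem mul_letterInv_cancel (x : ι × Bool) (g : G) :
    a.letter x * (a.letter (letterInv x) * g) = g := by
  rw [letter_letterInv, mul_inv_cancel_left]

variable [DecidableEq ι]

/-- The length of the reduced word of `g`. -/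
def len (g : G) : ℕ := (a.repr g).norm

/-- The first letter of the reduced word of `g`, and `none` if `g = 1`. -/
def firstLetter (g : G) : Option (ι × Bool) := (a.repr g).toWord.head?

@[simp] theorem len_one : a.len 1 = 0 := by simp [len]

theorem len_eq_zero {g : G} : a.len g = 0 ↔ g = 1 := by simp [len]

@[simp] theorem len_inv (g : G) : a.len g⁻¹ = a.len g := by simp [len]

theorem len_mul_le (g h : G) : a.len (g * h) ≤ a.len g + a.len h := by
  simpa [len] using FreeGroup.norm_mul_le (a.repr g) (a.repr h)

@[simp] theorem firstLetter_one : a.firstLetter 1 = none := by simp [firstLetter]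

theorem toWord_letter_mul (x : ι × Bool) (g : G) :
    (a.repr (a.letter x * g)).toWord =
      if a.firstLetter g = some (letterInv x) then (a.repr g).toWord.tail
      else x :: (a.repr g).toWord := by
  have h1 : (a.repr (a.letter x * g)).toWord = FreeGroup.reduce (x :: (a.repr g).toWord) := by
    rw [map_mul, letter, MulEquiv.apply_symm_apply]
    conv_lhs => rw [← FreeGroup.mk_toWord (x := a.repr g), FreeGroup.mul_mk, FreeGroup.toWord_mk]
    rfl
  rw [h1, FreeGroup.reduce.cons, FreeGroup.reduce_toWord, firstLetter]
  cases h : (a.repr g).toWord with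
  | nil => simp
  | cons y l =>
    obtain ⟨i, b⟩ := x
    obtain ⟨j, c⟩ := y
    simp only [List.head?_cons, Option.some.injEq, letterInv, List.tail_cons, Prod.mk.injEq]
    by_cases hij : i = j
    · subst hij
      cases b <;> cases c <;> simp
    · have hji : j ≠ i := Ne.symm hij
      simp [hij, hji]

variable {a}

theorem firstLetter_letter_mul {x : ι × Bool} {g : G}
    (h : a.firstLetter g ≠ some (letterInv x)) : a.firstLetter (a.letter x * g) = some x := by
  rw [firstLetter, toWord_letter_mul, if_neg h, List.head?_cons]

theorem len_letter_mul {x : ι × Bool} {g : G}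
    (h : a.firstLetter g ≠ some (letterInv x)) : a.len (a.letter x * g) = a.len g + 1 := by
  rw [len, FreeGroup.norm, toWord_letter_mul, if_neg h, List.length_cons, len, FreeGroup.norm]

theorem firstLetter_letterInv_mul_ne {x : ι × Bool} {g : G} (h : a.firstLetter g = some x) :
    a.firstLetter (a.letter (letterInv x) * g) ≠ some (letterInv x) := by
  -- otherwise the reduced word of `g` would begin with `x` followed by its inverse
  intro h'
  have h1 : (a.repr (a.letter (letterInv x) * g)).toWord = (a.repr g).toWord.tail := by
    rw [toWord_letter_mul, letterInv_letterInv, if_pos h]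
  have h2 := toWord_letter_mul a x (a.letter (letterInv x) * g)
  rw [if_pos h', mul_letterInv_cancel, h1] at h2
  have h3 : (a.repr g).toWord ≠ [] := by
    intro h0
    simp [firstLetter, h0] at h
  have h4 := congrArg List.length h2
  have h5 := List.length_pos_of_ne_nil h3
  simp only [List.length_tail] at h4
  omega

theorem firstLetter_eq_none {g : G} : a.firstLetter g = none ↔ g = 1 := by
  simp [firstLetter]

/-- A nontrivial element is a letter times a shorter element. -/
theorem exists_eq_letter_mul {g : G} (hg : g ≠ 1) : ∃ x h, g = a.letter x * h ∧
    a.firstLetter h ≠ some (letterInv x) := by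
  cases hx : a.firstLetter g with
  | none => exact absurd (firstLetter_eq_none.mp hx) hg
  | some x =>
    exact ⟨x, a.letter (letterInv x) * g, (mul_letterInv_cancel a x g).symm,
      firstLetter_letterInv_mul_ne hx⟩

/-- Induction on the reduced word. -/
theorem word_induction {p : G → Prop} (one : p 1)
    (mul : ∀ x g, a.firstLetter g ≠ some (letterInv x) → p g → p (a.letter x * g)) (g : G) :
    p g := by
  induction h : a.len g generalizing g with
  | zero => rwa [a.len_eq_zero.mp h]
  | succ n ih =>
    have hg : g ≠ 1 := by
      rintro rfl
      simp at h
    obtain ⟨x, k, rfl, hk⟩ := exists_eq_letter_mul (a := a) hg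
    rw [len_letter_mul hk] at h
    exact mul x k hk (ih k (by omega))

/-- Right multiplication by a letter does not change the first letter, unless it cancels it. -/
theorem firstLetter_mul_letter (y : ι × Bool) (g : G) (hg : g ≠ 1) :
    a.firstLetter (g * a.letter y) = a.firstLetter g ∨ g * a.letter y = 1 := by
  induction g using word_induction (a := a) with
  | one => exact absurd rfl hg
  | mul x g hx ih =>
    rw [firstLetter_letter_mul hx]
    by_cases h1 : g = 1
    · subst h1
      rw [mul_one]
      by_cases hy : y = letterInv x
      · right
        rw [hy, letter_letterInv, mul_inv_cancel]
      · left
        refine firstLetter_letter_mul ?_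
        rw [← mul_one (a.letter y), firstLetter_letter_mul (by simp)]
        simpa using hy
    · left
      rw [mul_assoc]
      refine firstLetter_letter_mul ?_
      rcases ih h1 with h | h
      · rwa [h]
      · simp [h]

/-- Right multiplication by a shorter element does not change the first letter. -/
theorem firstLetter_mul_of_len_lt {g h : G} (hlt : a.len h < a.len g) :
    a.firstLetter (g * h) = a.firstLetter g := by
  induction h using word_induction (a := a) generalizing g with
  | one => rw [mul_one]
  | mul y h hy ih =>
    rw [len_letter_mul hy] at hlt
    have h1 : a.len g ≤ a.len (g * a.letter y) + 1 := by
      have h2 := a.len_mul_le (g * a.letter y) (a.letter (letterInv y))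
      have h3 : a.len (a.letter (letterInv y)) = 1 := by
        rw [← mul_one (a.letter (letterInv y)), len_letter_mul (by simp), len_one]
      rwa [letter_letterInv, mul_inv_cancel_right, ← letter_letterInv, h3] at h2
    have hg : g ≠ 1 := by
      rintro rfl
      simp at hlt
    rw [← mul_assoc, ih (by omega)]
    refine (firstLetter_mul_letter y g hg).resolve_right fun h0 => ?_
    rw [h0, len_one] at h1
    omega

/-! ### Spheres and balls -/

theorem finite_len_le [Finite ι] (n : ℕ) : {g : G | a.len g ≤ n}.Finite := by
  refine (List.finite_length_le (ι × Bool) n).preimage (f := fun g => (a.repr g).toWord) ?_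
  exact (FreeGroup.toWord_injective.comp a.repr.injective).injOn

/-- The elements whose reduced word has `n` letters. -/
noncomputable def sphere [Finite ι] (a : FreeGroupBasis ι G) (n : ℕ) : Finset G :=
  ((finite_len_le (a := a) n).subset fun _ hg => le_of_eq hg :
    {g : G | a.len g = n}.Finite).toFinset

@[simp] theorem mem_sphere [Finite ι] {n : ℕ} {g : G} : g ∈ a.sphere n ↔ a.len g = n := by
  simp [sphere]

theorem sphere_zero [Finite ι] : a.sphere 0 = {1} := by
  ext g
  simp [len_eq_zero]

variable [Fintype ι]

open scoped Classical in
/-- Every element of length `n + 1` is in exactly one way a letter times an element of length `n`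
whose first letter it does not cancel. -/
theorem sum_sphere_succ {V : Type*} [AddCommMonoid V] (φ : G → V) (n : ℕ) :
    ∑ g ∈ a.sphere (n + 1), φ g =
      ∑ g ∈ a.sphere n, ∑ x with a.firstLetter g ≠ some (letterInv x), φ (a.letter x * g) := by
  rw [Finset.sum_sigma']
  symm
  refine Finset.sum_bij (fun p _ => a.letter p.2 * p.1) ?_ ?_ ?_ (fun _ _ => rfl)
  · rintro ⟨g, x⟩ h
    simp only [Finset.mem_sigma, mem_sphere, Finset.mem_filter_univ] at h ⊢
    rw [len_letter_mul h.2, h.1]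
  · rintro ⟨g, x⟩ h ⟨k, y⟩ h' heq
    simp only [Finset.mem_sigma, Finset.mem_filter_univ] at h h' heq
    have hxy := congrArg a.firstLetter heq
    rw [firstLetter_letter_mul h.2, firstLetter_letter_mul h'.2, Option.some.injEq] at hxy
    subst hxy
    rw [mul_left_cancel heq]
  · intro g hg
    rw [mem_sphere] at hg
    have hne : g ≠ 1 := by
      rintro rfl
      simp at hg
    obtain ⟨x, k, rfl, hk⟩ := exists_eq_letter_mul (a := a) hne
    rw [len_letter_mul hk] at hg
    exact ⟨⟨k, x⟩, by simpa [hk] using hg, rfl⟩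

theorem sum_sphere_one {V : Type*} [AddCommMonoid V] (φ : G → V) :
    ∑ g ∈ a.sphere 1, φ g = ∑ x, φ (a.letter x) := by
  rw [sum_sphere_succ, sphere_zero]
  simp

open scoped Classical in
theorem card_letters_ne {q : ℕ} (hq : Fintype.card (ι × Bool) = q + 1) (g : G) :
    (Finset.univ.filter fun x => a.firstLetter g ≠ some (letterInv x)).card =
      if g = 1 then q + 1 else q := by
  split_ifs with h
  · subst h
    simp [← hq]
  · cases hy : a.firstLetter g with
    | none => exact absurd (firstLetter_eq_none.mp hy) h
    | some y =>
      have : (Finset.univ.filter fun x => some y ≠ some (letterInv x)) =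
          Finset.univ.erase (letterInv y) := by
        ext x
        simp only [ne_eq, Option.some.injEq, Finset.mem_filter_univ, Finset.mem_erase,
          Finset.mem_univ, and_true, not_iff_not]
        constructor
        · rintro rfl
          simp
        · rintro rfl
          simp
      rw [this, Finset.card_erase_of_mem (Finset.mem_univ _), Finset.card_univ, hq]
      simp

open scoped Classical in
/-- Multiplying the sphere of radius `n + 1` by the letters gives the sphere of radius `n + 2` once
and each element `g` of the sphere of radius `n` as often as there are letters that do not cancel
the first letter of `g`. -/
theorem sum_letter_mul_sphere_succ {V : Type*} [AddCommMonoid V] {q : ℕ}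
    (hq : Fintype.card (ι × Bool) = q + 1) (φ : G → V) (n : ℕ) :
    ∑ g ∈ a.sphere (n + 1), ∑ x, φ (a.letter x * g) =
      ∑ g ∈ a.sphere (n + 2), φ g +
        ∑ g ∈ a.sphere n, (if g = 1 then q + 1 else q) • φ g := by
  have h1 : ∀ g : G, ∑ x, φ (a.letter x * g) =
      ∑ x with a.firstLetter g ≠ some (letterInv x), φ (a.letter x * g) +
        ∑ x with a.firstLetter g = some (letterInv x), φ (a.letter x * g) := by
    intro g
    rw [add_comm]
    exact (Finset.sum_filter_add_sum_filter_not _ _ _).symm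
  simp_rw [h1, Finset.sum_add_distrib]
  rw [← sum_sphere_succ, sum_sphere_succ (fun g =>
    ∑ x with a.firstLetter g = some (letterInv x), φ (a.letter x * g))]
  congr 1
  refine Finset.sum_congr rfl fun g _ => ?_
  rw [← card_letters_ne (a := a) hq g, ← Finset.sum_const]
  refine Finset.sum_congr rfl fun y hy => ?_
  rw [Finset.mem_filter_univ] at hy
  rw [firstLetter_letter_mul hy]
  have : (Finset.univ.filter fun x => some y = some (letterInv x)) = {letterInv y} := by
    ext x
    simp only [Option.some.injEq, Finset.mem_filter_univ, Finset.mem_singleton]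
    constructor <;> rintro rfl <;> simp
  rw [this, Finset.sum_singleton, letterInv_mul_cancel]

theorem card_sphere_succ {q : ℕ} (hq : Fintype.card (ι × Bool) = q + 1) (n : ℕ) :
    (a.sphere (n + 1)).card = (q + 1) * q ^ n := by
  classical
  have h : ∀ m, (a.sphere (m + 1)).card = ∑ g ∈ a.sphere m, if g = 1 then q + 1 else q := by
    intro m
    rw [Finset.card_eq_sum_ones, sum_sphere_succ]
    refine Finset.sum_congr rfl fun g _ => ?_
    rw [← card_letters_ne (a := a) hq g, Finset.card_eq_sum_ones]
  induction n with
  | zero => rw [h, sphere_zero]; simp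
  | succ n ih =>
    have : ∀ g ∈ a.sphere (n + 1), (if g = 1 then q + 1 else q) = q := by
      intro g hg
      rw [if_neg]
      rintro rfl
      simp at hg
    rw [h, Finset.sum_congr rfl this, Finset.sum_const, ih, smul_eq_mul]
    ring

end FreeGroupBasis

/-! ### The word metric of a free group -/

section

variable {G : Type*} [Group G] {r : ℕ} (a : FreeGroupBasis (Fin r) G)

open FreeGroupBasis

theorem mem_symmGenerators {g : G} : g ∈ symmGenerators a ↔ ∃ x, a.letter x = g := by
  have h1 : ∀ i, a.letter (i, true) = a i := fun i => rfl
  have h2 : ∀ i, a.letter (i, false) = (a i)⁻¹ := fun i => by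
    rw [← h1, ← letter_letterInv]
    rfl
  simp only [symmGenerators, Finset.mem_union, Finset.mem_image, Finset.mem_univ, true_and,
    Prod.exists, Bool.exists_bool, h1, h2, exists_or]
  exact or_comm

theorem wordDist_one_eq_len (g : G) :
    wordDist (symmGenerators a : Set G) 1 g = a.len g := by
  rw [wordDist, inv_one, one_mul]
  apply le_antisymm
  · have key : ∃ l : List G, (∀ s ∈ l, s ∈ (symmGenerators a : Set G)) ∧ l.prod = g ∧
        l.length = a.len g := by
      induction g using word_induction (a := a) with
      | one => exact ⟨[], by simp⟩
      | mul x g hx ih =>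
        obtain ⟨l, hl, hp, hn⟩ := ih
        refine ⟨a.letter x :: l, ?_, by simp [hp], by simp [hn, len_letter_mul hx]⟩
        simp only [List.mem_cons, forall_eq_or_imp]
        exact ⟨(mem_symmGenerators a).mpr ⟨x, rfl⟩, hl⟩
    obtain ⟨l, hl, hp, hn⟩ := key
    rw [← hn]
    exact iInf_le_of_le l (iInf_le_of_le hl (iInf_le _ hp))
  · refine le_iInf fun l => le_iInf fun hl => le_iInf fun hp => ?_
    rw [Nat.cast_le]
    subst hp
    induction l with
    | nil => simp
    | cons s l ih =>
      rw [List.prod_cons, List.length_cons, add_comm]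
      refine (a.len_mul_le _ _).trans (add_le_add ?_ (ih fun t ht => hl t (by simp [ht])))
      obtain ⟨x, rfl⟩ := (mem_symmGenerators a).mp (hl s (by simp))
      rw [← mul_one (a.letter x), len_letter_mul (by simp), len_one]

theorem wordSphere_eq_sphere (n : ℕ) : wordSphere (symmGenerators a) n = a.sphere n := by
  ext g
  simp [wordSphere, wordDist_one_eq_len]

theorem wordBall_eq_biUnion [DecidableEq G] (n : ℕ) :
    wordBall (symmGenerators a) n = (Finset.range (n + 1)).biUnion a.sphere := by
  ext g
  simp [wordBall, wordDist_one_eq_len]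

end

/-! ### Spherical polynomials of a regular tree -/

section SphericalPolynomials

open Polynomial

/-- The polynomial `P_n` such that, on the `(q+1)`-regular tree, the adjacency operator of the
relation "at distance `n`" is `P_n` of the adjacency operator of the tree. -/
noncomputable def spherePoly (q : ℝ) : ℕ → ℝ[X]
  | 0 => 1
  | 1 => X
  | 2 => X ^ 2 - C (q + 1)
  | n + 3 => X * spherePoly q (n + 2) - C q * spherePoly q (n + 1)

/-- The spherical polynomials in terms of the Chebyshev polynomials of both kinds. -/
theorem eval_spherePoly_succ {q : ℝ} (hq : 1 ≤ q) (y : ℝ) (n : ℕ) :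
    (spherePoly q (n + 1)).eval (2 * √q * y) =
      √q ^ (n + 1) * ((1 - 1 / q) * (Chebyshev.U ℝ (n + 1 : ℕ)).eval y +
        2 / q * (Chebyshev.T ℝ (n + 1 : ℕ)).eval y) := by
  have hq0 : q ≠ 0 := by positivity
  have hs : √q ^ 2 = q := Real.sq_sqrt (by positivity)
  induction n using Nat.twoStepInduction with
  | zero =>
    simp [spherePoly]
    field_simp
    ring
  | one =>
    simp only [spherePoly, eval_sub, eval_pow, eval_X, eval_C]
    norm_num [Chebyshev.U_two, Chebyshev.T_two]
    rw [mul_pow, mul_pow, hs]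
    field_simp
    ring
  | more n ih1 ih2 =>
    rw [spherePoly, eval_sub, eval_mul, eval_mul, eval_X, eval_C, ih1, ih2]
    have hU := congrArg (eval y) (Chebyshev.U_add_two ℝ (n + 1 : ℕ))
    have hT := congrArg (eval y) (Chebyshev.T_add_two ℝ (n + 1 : ℕ))
    simp only [eval_sub, eval_mul, eval_X, eval_ofNat] at hU hT
    push_cast at hU hT ⊢
    have e1 : (n : ℤ) + 1 + 2 = n + 2 + 1 := by ring
    rw [e1] at hU hT
    rw [hU, hT]
    have h3 : √q ^ (n + 2 + 1) = √q ^ (n + 1) * q := by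
      calc √q ^ (n + 2 + 1) = √q ^ (n + 1) * √q ^ 2 := by ring
        _ = _ := by rw [hs]
    have h4 : √q ^ (n + 1 + 1) = √q ^ (n + 1) * √q := pow_succ _ _
    rw [h3, h4]
    linear_combination (2 * y * √q ^ (n + 1) * ((1 - 1 / q) * (Chebyshev.U ℝ (n + 1 + 1)).eval y +
        2 / q * (Chebyshev.T ℝ (n + 1 + 1)).eval y)) * hs

theorem abs_eval_U_le (n : ℕ) {y : ℝ} (hy : |y| ≤ 1) :
    |(Chebyshev.U ℝ n).eval y| ≤ n + 1 := by
  induction n with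
  | zero => simp
  | succ n ih =>
    have h := congrArg (eval y) (Chebyshev.U_eq_X_mul_U_add_T ℝ n)
    rw [eval_add, eval_mul, eval_X] at h
    push_cast
    rw [h]
    calc |y * (Chebyshev.U ℝ n).eval y + (Chebyshev.T ℝ (n + 1)).eval y|
        ≤ |y| * |(Chebyshev.U ℝ n).eval y| + |(Chebyshev.T ℝ (n + 1)).eval y| := by
          rw [← abs_mul]
          exact abs_add_le _ _
      _ ≤ 1 * (n + 1) + 1 := by
          gcongr
          exact Chebyshev.abs_eval_T_real_le_one _ hy
      _ = n + 1 + 1 := by ring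

theorem eval_spherePoly_succ_two_sqrt {q : ℝ} (hq : 1 ≤ q) (n : ℕ) :
    (spherePoly q (n + 1)).eval (2 * √q) = √q ^ (n + 1) * ((1 - 1 / q) * (n + 2) + 2 / q) := by
  have h := eval_spherePoly_succ hq 1 n
  rw [Chebyshev.U_eval_one, Chebyshev.T_eval_one, mul_one, mul_one] at h
  rw [h]
  push_cast
  ring

/-- On `[-2 √q, 2 √q]`, the polynomial `P_n` attains the maximum of its absolute value at `2 √q`, as
do the Chebyshev polynomials `U_n` and `T_n` on `[-1, 1]` at `1`. -/
theorem abs_eval_spherePoly_le {q : ℝ} (hq : 1 ≤ q) (n : ℕ) {x : ℝ} (hx : |x| ≤ 2 * √q) :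
    |(spherePoly q n).eval x| ≤ (spherePoly q n).eval (2 * √q) := by
  cases n with
  | zero => simp [spherePoly]
  | succ n =>
    have hs : 0 < 2 * √q := by positivity
    have hxy : x = 2 * √q * (x / (2 * √q)) := by field_simp
    have hy : |x / (2 * √q)| ≤ 1 := by
      rw [abs_div, abs_of_pos hs]
      exact (div_le_one hs).mpr hx
    have hq1 : 0 ≤ 1 - 1 / q := by
      rw [sub_nonneg]
      exact (div_le_one (by positivity)).mpr hq
    rw [hxy, eval_spherePoly_succ hq, eval_spherePoly_succ_two_sqrt hq, abs_mul,
      abs_of_nonneg (by positivity : (0 : ℝ) ≤ √q ^ (n + 1))]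
    gcongr
    refine (abs_add_le _ _).trans ?_
    rw [abs_mul, abs_mul, abs_of_nonneg hq1, abs_of_nonneg (by positivity : 0 ≤ 2 / q)]
    have h1 := abs_eval_U_le (n + 1) hy
    have h2 := Chebyshev.abs_eval_T_real_le_one (n + 1 : ℕ) hy
    push_cast at h1 h2 ⊢
    have h3 : 2 / q * |(Chebyshev.T ℝ (n + 1)).eval (x / (2 * √q))| ≤ 2 / q * 1 := by gcongr
    have h4 : (1 - 1 / q) * |(Chebyshev.U ℝ (n + 1)).eval (x / (2 * √q))| ≤
      (1 - 1 / q) * (n + 1 + 1) := by gcongr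
    linarith

end SphericalPolynomials

/-! ### The norm of polynomials of a self-adjoint operator -/

section OperatorNorm

open Polynomial

variable {E : Type*} [NormedAddCommGroup E] [InnerProductSpace ℂ E]

theorem norm_sum_sq_of_orthogonal {J : Type*} {s : Finset J} {u : J → E}
    (h : ∀ j ∈ s, ∀ k ∈ s, j ≠ k → inner ℂ (u j) (u k) = 0) :
    ‖∑ k ∈ s, u k‖ ^ 2 = ∑ k ∈ s, ‖u k‖ ^ 2 := by
  have h1 : inner ℂ (∑ k ∈ s, u k) (∑ k ∈ s, u k) = ∑ k ∈ s, inner ℂ (u k) (u k) := by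
    rw [sum_inner]
    refine Finset.sum_congr rfl fun j hj => ?_
    rw [inner_sum, Finset.sum_eq_single_of_mem j hj fun k hk hkj => h j hj k hk hkj.symm]
  have h2 := congrArg Complex.re h1
  rw [Complex.re_sum] at h2
  simpa only [← RCLike.re_eq_complex_re, inner_self_eq_norm_sq] using h2

theorem norm_aeval_le [CompleteSpace E] {T : E →L[ℂ] E} (hT : IsSelfAdjoint T) (p : ℝ[X]) {c m : ℝ}
    (hc : ‖T‖ ≤ c) (hm : 0 ≤ m) (hp : ∀ x : ℝ, |x| ≤ c → |p.eval x| ≤ m) : ‖aeval T p‖ ≤ m := by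
  rw [← cfc_polynomial p T hT]
  refine norm_cfc_le hm fun x hx => hp x ?_
  have h : ((x : ℝ) : ℂ) ∈ spectrum ℂ T := by
    simpa using spectrum.algebraMap_mem ℂ hx
  have := spectrum.norm_le_norm_mul_of_mem h
  cases subsingleton_or_nontrivial E with
  | inl hE =>
    exact absurd hx (by simp [spectrum.of_subsingleton])
  | inr hE =>
    rw [norm_one, mul_one] at this
    simpa using this.trans hc

/-- If `T` has vectors `v` of arbitrarily large norm with `(T - c) v` bounded, then `c` is an
approximate eigenvalue, and `|p(c)|` is at most the norm of `p(T)` for each polynomial `p`. -/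
theorem abs_eval_le_norm_aeval {T : E →L[ℂ] E} {c K : ℝ}
    (hc : ∀ M : ℝ, ∃ v : E, M ≤ ‖v‖ ∧ ‖T v - (c : ℂ) • v‖ ≤ K) (p : ℝ[X]) :
    |p.eval c| ≤ ‖aeval T p‖ := by
  obtain ⟨Q, hQ⟩ := X_sub_C_dvd_sub_C_eval (a := c) (p := p)
  have hop : aeval T p = aeval T Q * (T - algebraMap ℝ _ c) + algebraMap ℝ _ (p.eval c) := by
    have := congrArg (aeval T) (sub_eq_iff_eq_add.mp hQ)
    rw [mul_comm] at this
    simpa using this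
  by_contra! hlt
  set δ := |p.eval c| - ‖aeval T p‖ with hδ
  have hδ0 : 0 < δ := by linarith
  obtain ⟨v, hv, hK⟩ := hc ((‖aeval T Q‖ * K + 1) / δ)
  have e1 : (algebraMap ℝ (E →L[ℂ] E) c) v = (c : ℂ) • v := by
    rw [Algebra.algebraMap_eq_smul_one]
    simp
  have e2 : (algebraMap ℝ (E →L[ℂ] E) (p.eval c)) v = ((p.eval c : ℝ) : ℂ) • v := by
    rw [Algebra.algebraMap_eq_smul_one]
    simp
  have hpv : ((p.eval c : ℝ) : ℂ) • v = aeval T p v - aeval T Q (T v - (c : ℂ) • v) := by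
    rw [hop]
    simp [e1, e2]
  have h1 : |p.eval c| * ‖v‖ ≤ ‖aeval T p‖ * ‖v‖ + ‖aeval T Q‖ * K := by
    have : ‖((p.eval c : ℝ) : ℂ) • v‖ = |p.eval c| * ‖v‖ := by rw [norm_smul]; simp
    rw [← this, hpv]
    refine (norm_sub_le _ _).trans (add_le_add (ContinuousLinearMap.le_opNorm _ _) ?_)
    exact (ContinuousLinearMap.le_opNorm _ _).trans (by gcongr)
  rw [div_le_iff₀ hδ0, hδ] at hv
  nlinarith

/-- A sequence of operators satisfying the recursion of the sphere operators of the
`(q+1)`-regular tree. -/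
structure IsSphereSequence (q : ℝ) (A : ℕ → E →L[ℂ] E) : Prop where
  zero : A 0 = 1
  one_mul_one : A 1 * A 1 = A 2 + (q + 1) • (1 : E →L[ℂ] E)
  one_mul_succ_succ : ∀ n, A 1 * A (n + 2) = A (n + 3) + q • A (n + 1)

namespace IsSphereSequence

variable {q : ℝ} {A : ℕ → E →L[ℂ] E}

theorem eq_aeval (h : IsSphereSequence q A) (n : ℕ) : A n = aeval (A 1) (spherePoly q n) := by
  induction n using Nat.strong_induction_on with
  | _ n ih =>
    match n with
    | 0 => simp [spherePoly, h.zero]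
    | 1 => simp [spherePoly]
    | 2 =>
      rw [spherePoly, map_sub, map_pow, aeval_X, aeval_C, sq, h.one_mul_one,
        Algebra.algebraMap_eq_smul_one, add_sub_cancel_right]
    | n + 3 =>
      rw [spherePoly, map_sub, map_mul, map_mul, aeval_X, aeval_C, ← ih (n + 2) (by omega),
        ← ih (n + 1) (by omega), h.one_mul_succ_succ, Algebra.algebraMap_eq_smul_one,
        smul_mul_assoc, one_mul, add_sub_cancel_right]

/-- If the vectors `A k e` behave, for `k ≤ N + 1`, like the indicator functions of the spheres of
the tree, then the truncated radial function `∑_{k ≤ N} q^{-k/2} A k e` is an approximate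
eigenvector of `A 1` for the eigenvalue `2 √q`. -/
theorem exists_approximate_eigenvector (h : IsSphereSequence q A) (hq : 1 ≤ q)
    (test : ∀ N, ∃ e : E,
      (∀ j ≤ N, ∀ k ≤ N, j ≠ k → inner ℂ (A j e) (A k e) = 0) ∧ ‖e‖ = 1 ∧
      ∀ k < N, ‖A (k + 1) e‖ ^ 2 = (q + 1) * q ^ k) (M : ℝ) :
    ∃ v : E, M ≤ ‖v‖ ∧
      ‖A 1 v - ((2 * √q : ℝ) : ℂ) • v‖ ≤ 2 * √q * √((q + 1) / q) + √q + 1 / √q := by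
  have hq0 : 0 < q := by linarith
  have hs0 : 0 < √q := Real.sqrt_pos.mpr hq0
  have hss : √q ^ 2 = q := Real.sq_sqrt hq0.le
  obtain ⟨N, hN⟩ := exists_nat_ge (M ^ 2)
  obtain ⟨e, orth, he, hnorm⟩ := test (N + 2)
  set s : ℝ := √q with hs
  -- all `u k` with `1 ≤ k` have the same norm, and `A 1` sends `u k` to `√q (u (k+1) + u (k-1))`,
  -- up to a multiple of `u 0` if `k ≤ 1`
  set u : ℕ → E := fun k => (s ^ k)⁻¹ • A k e with hu
  have hu0 : ‖u 0‖ = 1 := by simp [hu, h.zero, he]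
  have hun : ∀ k < N + 2, ‖u (k + 1)‖ = √((q + 1) / q) := by
    intro k hk
    rw [← Real.sqrt_sq (norm_nonneg (u (k + 1)))]
    congr 1
    simp only [hu]
    rw [norm_smul, mul_pow, hnorm k hk, norm_inv, Real.norm_of_nonneg (by positivity), inv_pow,
      ← pow_mul, mul_comm (k + 1) 2, pow_mul, hss]
    field_simp
    ring
  have hnz : ∀ k < N + 2, 1 ≤ ‖u k‖ ^ 2 := by
    intro k hk
    cases k with
    | zero => rw [hu0]; norm_num
    | succ k =>
      rw [hun k (by omega), Real.sq_sqrt (by positivity), le_div_iff₀ hq0]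
      linarith
  have t0 : A 1 (u 0) = s • u 1 := by
    simp only [hu, h.zero]
    rw [smul_smul]
    simp [hs0.ne']
  have t1 : A 1 (u 1) = s • u 2 + s • u 0 + s⁻¹ • u 0 := by
    have := DFunLike.congr_fun h.one_mul_one e
    simp only [mul_apply_eq_comp, add_apply,
      smul_apply, one_apply_eq_self] at this
    simp only [hu, h.zero, one_apply_eq_self, ContinuousLinearMap.map_smul_of_tower, this]
    rw [← hss]
    match_scalars <;> field_simp
  have t2 : ∀ k, A 1 (u (k + 2)) = s • u (k + 3) + s • u (k + 1) := by
    intro k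
    have := DFunLike.congr_fun (h.one_mul_succ_succ k) e
    simp only [mul_apply_eq_comp, add_apply,
      smul_apply] at this
    simp only [hu, ContinuousLinearMap.map_smul_of_tower, this]
    rw [← hss]
    match_scalars <;> field_simp <;> ring
  -- the sum telescopes up to the boundary terms
  have hsum : ∀ n, A 1 (∑ k ∈ Finset.range (n + 2), u k) -
      (2 * s) • ∑ k ∈ Finset.range (n + 2), u k =
      s • u (n + 2) - s • u (n + 1) - s • u 0 + s⁻¹ • u 0 := by
    intro n
    induction n with
    | zero =>
      simp only [Finset.sum_range_succ, Finset.sum_range_zero, map_add, t0, t1, zero_add]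
      module
    | succ n ih =>
      rw [Finset.sum_range_succ, map_add, smul_add, t2]
      rw [sub_eq_iff_eq_add] at ih
      rw [ih]
      module
  refine ⟨∑ k ∈ Finset.range (N + 2), u k, ?_, ?_⟩
  · have horth : ∀ j ∈ Finset.range (N + 2), ∀ k ∈ Finset.range (N + 2), j ≠ k →
        inner ℂ (u j) (u k) = 0 := by
      intro j hj k hk hjk
      rw [Finset.mem_range] at hj hk
      simp only [hu]
      rw [← Complex.coe_smul, ← Complex.coe_smul, inner_smul_left,
        inner_smul_right, orth j (by omega) k (by omega) hjk]
      simp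
    have hpyth : ‖∑ k ∈ Finset.range (N + 2), u k‖ ^ 2 =
        ∑ k ∈ Finset.range (N + 2), ‖u k‖ ^ 2 := norm_sum_sq_of_orthogonal horth
    have hge : (N : ℝ) ≤ ‖∑ k ∈ Finset.range (N + 2), u k‖ ^ 2 := by
      rw [hpyth]
      calc (N : ℝ) ≤ ∑ k ∈ Finset.range (N + 2), (1 : ℝ) := by simp
        _ ≤ _ := Finset.sum_le_sum fun k hk => hnz k (Finset.mem_range.mp hk)
    exact le_of_sq_le_sq (hN.trans hge) (norm_nonneg _)
  · rw [Complex.coe_smul, hsum]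
    have n1 : ‖s • u (N + 2)‖ = s * √((q + 1) / q) := by
      rw [norm_smul, Real.norm_of_nonneg hs0.le, hun (N + 1) (by omega)]
    have n2 : ‖s • u (N + 1)‖ = s * √((q + 1) / q) := by
      rw [norm_smul, Real.norm_of_nonneg hs0.le, hun N (by omega)]
    have n3 : ‖s • u 0‖ = s := by
      rw [norm_smul, Real.norm_of_nonneg hs0.le, hu0, mul_one]
    have n4 : ‖s⁻¹ • u 0‖ = 1 / s := by
      rw [norm_smul, norm_inv, Real.norm_of_nonneg hs0.le, hu0, mul_one, one_div]
    refine (norm_add_le _ _).trans ?_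
    have m1 := norm_sub_le (s • u (N + 2) - s • u (N + 1)) (s • u 0)
    have m2 := norm_sub_le (s • u (N + 2)) (s • u (N + 1))
    linarith

theorem norm_sum_eq [CompleteSpace E] (h : IsSphereSequence q A) (hq : 1 ≤ q)
    (hself : IsSelfAdjoint (A 1)) (hnorm : ‖A 1‖ ≤ 2 * √q)
    (test : ∀ N, ∃ e : E,
      (∀ j ≤ N, ∀ k ≤ N, j ≠ k → inner ℂ (A j e) (A k e) = 0) ∧ ‖e‖ = 1 ∧
      ∀ k < N, ‖A (k + 1) e‖ ^ 2 = (q + 1) * q ^ k) (I : Finset ℕ) :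
    ‖∑ k ∈ I, A k‖ = ∑ k ∈ I, (spherePoly q k).eval (2 * √q) := by
  have hpos : ∀ k, 0 ≤ (spherePoly q k).eval (2 * √q) := fun k =>
    (abs_nonneg _).trans (abs_eval_spherePoly_le hq k (abs_of_nonneg (by positivity)).le)
  have heq : ∑ k ∈ I, A k = aeval (A 1) (∑ k ∈ I, spherePoly q k) := by
    rw [map_sum]
    exact Finset.sum_congr rfl fun k _ => h.eq_aeval k
  rw [heq, ← eval_finsetSum]
  apply le_antisymm
  · refine norm_aeval_le hself _ hnorm ?_ fun x hx => ?_
    · rw [eval_finsetSum]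
      exact Finset.sum_nonneg fun k _ => hpos k
    · rw [eval_finsetSum, eval_finsetSum]
      exact (Finset.abs_sum_le_sum_abs _ _).trans
        (Finset.sum_le_sum fun k _ => abs_eval_spherePoly_le hq k hx)
  · exact (le_abs_self _).trans
      (abs_eval_le_norm_aeval (h.exists_approximate_eigenvector hq test) _)

end IsSphereSequence

end OperatorNorm

namespace FreeGroupBasis

open Filter

variable {ι G : Type*} [DecidableEq ι] [Group G] {a : FreeGroupBasis ι G}

/-! ### Orientations of Schreier graphs -/

/-- In the Schreier graph of a free group on the left cosets of a commutative subgroup `H`, one can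
choose at most one edge at each vertex in such a way that every edge is chosen from at least one of
its ends. Here `σ g = some s` means that the edge from `g` to `s⁻¹ g` is chosen at `g`. If `H` is
trivial, the choice is the edge towards the identity; otherwise it is the
edge towards the point at infinity `lim hⁿ`, where `h ≠ 1` is in `H`: this point is fixed by `H`. -/
theorem exists_orientation_of_commutative [Finite ι] (a : FreeGroupBasis ι G) (H : Subgroup G)
    (hH : ∀ g ∈ H, ∀ h ∈ H, g * h = h * g) : ∃ σ : G → Option (ι × Bool),
      (∀ g s, σ g ≠ some (letterInv s) → σ (a.letter s * g) = some s) ∧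
      ∀ g, ∀ h ∈ H, σ (g * h) = σ g := by
  by_cases htriv : ∀ h ∈ H, h = 1
  · exact ⟨a.firstLetter, fun g s => firstLetter_letter_mul, fun g h hh => by
      rw [htriv h hh, mul_one]⟩
  push Not at htriv
  obtain ⟨h, hh, hne⟩ := htriv
  have hinj : Function.Injective fun n : ℕ => h ^ n := by
    have h1 : a.repr h ≠ 1 := by simpa using hne
    have h2 : ¬ IsOfFinOrder (a.repr h) := not_isOfFinOrder_of_isMulTorsionFree h1
    intro m n hmn
    refine injective_pow_iff_not_isOfFinOrder.mpr h2 ?_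
    simpa using congrArg a.repr hmn
  -- the limit is taken along an ultrafilter; it exists since there are finitely many letters
  let U : Ultrafilter ℕ := Ultrafilter.of atTop
  have hU : (U : Filter ℕ) ≤ atTop := Ultrafilter.of_le atTop
  have hlim : ∀ g : G, ∃ o, ∀ᶠ n in (U : Filter ℕ), a.firstLetter (g * h ^ n) = o := by
    intro g
    have := Ultrafilter.eventually_exists_iff (f := U)
      (P := fun (o : Option (ι × Bool)) n => a.firstLetter (g * h ^ n) = o)
    exact this.mp (Eventually.of_forall fun n => ⟨_, rfl⟩)
  choose σ hσ using hlim
  refine ⟨σ, fun g s hgs => ?_, fun g k hk => ?_⟩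
  · obtain ⟨n, h1, h2⟩ := ((hσ g).and (hσ (a.letter s * g))).exists
    rw [← h2, mul_assoc]
    exact firstLetter_letter_mul (by rwa [h1])
  · have hlong : ∀ᶠ n in (U : Filter ℕ), a.len k < a.len (g * h ^ n) := by
      apply hU
      have hinj' : Function.Injective fun n : ℕ => g * h ^ n := fun m n hmn =>
        hinj (mul_left_cancel hmn)
      have hfin := (finite_len_le (a := a) (a.len k)).preimage hinj'.injOn
      rw [← Nat.cofinite_eq_atTop]
      filter_upwards [hfin.compl_mem_cofinite] with n hn
      simpa using hn
    obtain ⟨n, h1, h2, h3⟩ := ((hσ g).and ((hσ (g * k)).and hlong)).exists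
    -- `g k hⁿ = (g hⁿ) k`, where `g hⁿ` is eventually longer than `k`
    have hcomm : k * h ^ n = h ^ n * k := (hH _ hk _ (H.pow_mem hh n))
    rw [← h1, ← h2, mul_assoc, hcomm, ← mul_assoc, firstLetter_mul_of_len_lt h3]

/-- The orientation of `exists_orientation_of_commutative` on a union `Y` of orbits with commutative
stabilizers. -/
theorem exists_orientation [Finite ι] (a : FreeGroupBasis ι G) {X : Type*} [MulAction G X]
    (Y : Set X)
    (hY : ∀ (g : G), ∀ x ∈ Y, g • x ∈ Y)
    (hstab : ∀ x ∈ Y, ∀ g h : G, g • x = x → h • x = x → g * h = h * g) :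
    ∃ σ : X → Option (ι × Bool), ∀ x ∈ Y, ∀ s, σ x ≠ some (letterInv s) →
      σ (a.letter s • x) = some s := by
  have h1 : ∀ x : X, ∃ σ : G → Option (ι × Bool), x ∈ Y →
      (∀ g s, σ g ≠ some (letterInv s) → σ (a.letter s * g) = some s) ∧
      ∀ g h : G, h • x = x → σ (g * h) = σ g := by
    intro x
    by_cases hx : x ∈ Y
    · obtain ⟨σ, hσ, hσ'⟩ := a.exists_orientation_of_commutative (MulAction.stabilizer G x)
        fun g hg h hh => hstab x hx g h hg hh
      exact ⟨σ, fun _ => ⟨hσ, fun g h hh => hσ' g h hh⟩⟩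
    · exact ⟨fun _ => none, fun h => absurd h hx⟩
  choose τ hτ using h1
  let rep : X → X := fun x => (Quotient.mk (MulAction.orbitRel G X) x).out
  have hrep : ∀ x, ∃ g : G, g • rep x = x := fun x =>
    (MulAction.orbitRel_apply.mp
      ((MulAction.orbitRel G X).symm (Quotient.mk_out (s := MulAction.orbitRel G X) x)))
  have hrep_smul : ∀ (g : G) x, rep (g • x) = rep x := by
    intro g x
    have : Quotient.mk (MulAction.orbitRel G X) (g • x) = Quotient.mk (MulAction.orbitRel G X) x :=
      Quotient.sound (MulAction.orbitRel_apply.mpr ⟨g, rfl⟩)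
    exact congrArg Quotient.out this
  choose γ hγ using hrep
  refine ⟨fun x => τ (rep x) (γ x), fun x hx s hs => ?_⟩
  have hrx : rep x ∈ Y := by
    have := hY (γ x)⁻¹ x hx
    rwa [inv_smul_eq_iff.mpr (hγ x).symm] at this
  obtain ⟨h2, h3⟩ := hτ (rep x) hrx
  simp only [hrep_smul]
  -- `γ (s x)` and `s γ x` differ by an element of the stabilizer of the common representative
  have h4 : γ (a.letter s • x) =
      a.letter s * γ x * ((a.letter s * γ x)⁻¹ * γ (a.letter s • x)) := by group
  have h5 : ((a.letter s * γ x)⁻¹ * γ (a.letter s • x)) • rep x = rep x := by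
    have := hγ (a.letter s • x)
    rw [hrep_smul] at this
    rw [mul_smul, this, inv_smul_eq_iff, mul_smul, hγ]
  rw [h4, h3 _ _ h5]
  exact h2 _ _ hs

variable [Fintype ι]

/-- The weights `√q` on one letter and `1 / √q` on the other `q` letters add up to `2 √q`; without a
distinguished letter they add up to `(q + 1) / √q`, which is at most `2 √q`. -/
theorem sum_weight_le {q : ℝ} (hq : 1 ≤ q) (hcard : (Fintype.card (ι × Bool) : ℝ) = q + 1)
    {f : ι × Bool → ι × Bool} (hf : Function.Injective f) (o : Option (ι × Bool)) :
    ∑ s, (if o = some (f s) then √q else 1 / √q) ≤ 2 * √q := by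
  have hs : 0 < √q := Real.sqrt_pos.mpr (by linarith)
  have hss : √q ^ 2 = q := Real.sq_sqrt (by linarith)
  rcases o with _ | x
  · simp only [reduceCtorEq, if_false, Finset.sum_const, Finset.card_univ, nsmul_eq_mul, hcard]
    rw [mul_one_div, div_le_iff₀ hs]
    nlinarith
  · obtain ⟨y, rfl⟩ := (Finite.injective_iff_surjective.mp hf) x
    have h1 : ∀ s, (if some (f y) = some (f s) then √q else 1 / √q) =
        1 / √q + if y = s then √q - 1 / √q else 0 := by
      intro s
      by_cases h : y = s
      · simp [h]
      · simp [h, hf.ne h]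
    simp only [h1, Finset.sum_add_distrib, Finset.sum_const, Finset.card_univ, nsmul_eq_mul, hcard,
      Finset.sum_ite_eq, Finset.mem_univ, if_true]
    apply le_of_eq
    field_simp
    rw [hss]
    ring

/-- The Schur test: on the Schreier graph of an action of a free group, an orientation `σ` as in
`exists_orientation` bounds the norm of the adjacency operator on `ℓ²` by `2 √q`. -/
theorem schur_test {X : Type*} [MulAction G X] {q : ℝ} (hq : 1 ≤ q)
    (hcard : (Fintype.card (ι × Bool) : ℝ) = q + 1) (σ : X → Option (ι × Bool)) {b c : X → ℝ}
    (hσ : ∀ x, c x ≠ 0 → ∀ s, σ x ≠ some (letterInv s) → σ (a.letter s • x) = some s)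
    {B C : ℝ} (hB : HasSum (fun x => b x ^ 2) B) (hC : HasSum (fun x => c x ^ 2) C)
    (hb : ∀ x, |b x| ≤ ∑ s, c ((a.letter s)⁻¹ • x)) : B ≤ (2 * √q) ^ 2 * C := by
  have hs0 : 0 < √q := Real.sqrt_pos.mpr (by linarith)
  have hs1 : 1 ≤ √q := Real.one_le_sqrt.mpr hq
  -- the weight of the edge from `x` to `s⁻¹ x`
  let w : X → ι × Bool → ℝ := fun x s => if σ x = some s then √q else 1 / √q
  have hw0 : ∀ x s, 0 < w x s := fun x s => by
    simp only [w]
    split_ifs <;> positivity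
  have hw1 : ∀ x s, (w x s)⁻¹ ≤ √q := fun x s => by
    simp only [w]
    split_ifs
    · exact (inv_le_one_of_one_le₀ hs1).trans hs1
    · simp
  have hwsum : ∀ x, ∑ s, w x s ≤ 2 * √q := fun x =>
    sum_weight_le hq hcard Function.injective_id (σ x)
  have hsummable : ∀ s, Summable fun y => (w (a.letter s • y) s)⁻¹ * c y ^ 2 := fun s =>
    Summable.of_nonneg_of_le (fun y => mul_nonneg (inv_nonneg.mpr (hw0 _ _).le) (sq_nonneg _))
      (fun y => mul_le_mul_of_nonneg_right (hw1 _ _) (sq_nonneg _)) (hC.summable.mul_left √q)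
  choose K hK using hsummable
  have hK' : ∀ s, HasSum (fun x => (w x s)⁻¹ * c ((a.letter s)⁻¹ • x) ^ 2) (K s) := fun s => by
    rw [← (MulAction.toPerm (a.letter s)).hasSum_iff]
    simpa [Function.comp_def] using hK s
  have h1 : ∑ s, K s ≤ 2 * √q * C := by
    refine hasSum_le (fun y => ?_) (hasSum_sum fun s _ => hK s) (hC.mul_left (2 * √q))
    rw [← Finset.sum_mul]
    by_cases hy : c y = 0
    · simp [hy]
    refine mul_le_mul_of_nonneg_right ?_ (sq_nonneg _)
    refine le_trans (Finset.sum_le_sum fun s _ => ?_) (sum_weight_le hq hcard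
      (Function.LeftInverse.injective letterInv_letterInv) (σ y))
    split_ifs with h
    · exact hw1 _ _
    · simp [w, hσ y hy s h]
  have h2 : B ≤ 2 * √q * ∑ s, K s := by
    refine hasSum_le (fun x => ?_) hB ((hasSum_sum fun s _ => hK' s).mul_left (2 * √q))
    calc b x ^ 2 ≤ (∑ s, c ((a.letter s)⁻¹ • x)) ^ 2 := sq_le_sq' (neg_le_of_abs_le (hb x))
          (le_of_abs_le (hb x))
      _ ≤ (∑ s, w x s) * ∑ s, (w x s)⁻¹ * c ((a.letter s)⁻¹ • x) ^ 2 := by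
          refine Finset.sum_sq_le_sum_mul_sum_of_sq_le_mul _ (fun s _ => (hw0 x s).le)
            (fun s _ => mul_nonneg (inv_nonneg.mpr (hw0 _ _).le) (sq_nonneg _)) fun s _ => ?_
          rw [mul_inv_cancel_left₀ (hw0 x s).ne']
      _ ≤ 2 * √q * ∑ s, (w x s)⁻¹ * c ((a.letter s)⁻¹ • x) ^ 2 :=
          mul_le_mul_of_nonneg_right (hwsum x) (Finset.sum_nonneg fun s _ =>
            mul_nonneg (inv_nonneg.mpr (hw0 _ _).le) (sq_nonneg _))
  calc B ≤ 2 * √q * ∑ s, K s := h2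
    _ ≤ 2 * √q * (2 * √q * C) := by gcongr
    _ = _ := by ring

/-! ### Spheres in a representation -/

variable {E : Type*} [NormedAddCommGroup E] [InnerProductSpace ℂ E]

/-- In each representation of a free group, the sums over the spheres satisfy the recursion of the
sphere operators of the tree. -/
theorem isSphereSequence {d : ℕ} (hd : Fintype.card (ι × Bool) = d + 1) (π : G →* (E →L[ℂ] E)) :
    IsSphereSequence (d : ℝ) fun n => ∑ g ∈ a.sphere n, π g := by
  classical
  have key : ∀ n, (∑ g ∈ a.sphere 1, π g) * ∑ g ∈ a.sphere (n + 1), π g =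
      ∑ g ∈ a.sphere (n + 2), π g + ∑ g ∈ a.sphere n, (if g = 1 then d + 1 else d) • π g := by
    intro n
    rw [← sum_letter_mul_sphere_succ hd, sum_sphere_one, Finset.sum_comm, Finset.sum_mul_sum]
    simp_rw [map_mul]
  refine ⟨by simp [sphere_zero], ?_, fun n => ?_⟩
  · refine (key 0).trans ?_
    simp only [sphere_zero, Finset.sum_singleton, if_true, map_one]
    rw [← Nat.cast_smul_eq_nsmul ℝ]
    push_cast
    rfl
  · refine (key (n + 1)).trans ?_
    congr 1
    rw [Finset.smul_sum]
    refine Finset.sum_congr rfl fun g hg => ?_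
    rw [if_neg, Nat.cast_smul_eq_nsmul ℝ]
    rintro rfl
    simp at hg

end FreeGroupBasis

/-! ### The action of `GL(2, ℤ)` on the characters of the torus -/

/-- The group `ℤ²` of the characters of the torus. It is a type synonym, which carries the dual
action of `GL(2, ℤ)`. -/
def DualLattice : Type := Fin 2 → ℤ

instance : Zero DualLattice := inferInstanceAs (Zero (Fin 2 → ℤ))

/-- The dual action `A • k = k A⁻¹` on row vectors `k`. -/
instance : MulAction (GL (Fin 2) ℤ) DualLattice where
  smul A k := Matrix.vecMul (k : Fin 2 → ℤ) (A⁻¹ : GL (Fin 2) ℤ).val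
  one_smul k := by
    have h (v : Fin 2 → ℤ) : Matrix.vecMul v (1⁻¹ : GL (Fin 2) ℤ).val = v := by
      rw [inv_one, Units.val_one, Matrix.vecMul_one]
    exact h k
  mul_smul A B k := by
    have h (v : Fin 2 → ℤ) : Matrix.vecMul v ((A * B)⁻¹ : GL (Fin 2) ℤ).val =
        Matrix.vecMul (Matrix.vecMul v (B⁻¹ : GL (Fin 2) ℤ).val) (A⁻¹ : GL (Fin 2) ℤ).val := by
      rw [Matrix.vecMul_vecMul, _root_.mul_inv_rev, Units.val_mul]
    exact h k

theorem dual_smul_zero (A : GL (Fin 2) ℤ) : A • (0 : DualLattice) = 0 :=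
  Matrix.zero_vecMul _

theorem dual_smul_ne_zero (A : GL (Fin 2) ℤ) {k : DualLattice} (hk : k ≠ 0) : A • k ≠ 0 := by
  intro h
  rw [smul_eq_iff_eq_inv_smul, dual_smul_zero] at h
  exact hk h

open Matrix in
/-- Two matrices that fix the row vector `k ≠ 0` commute if they are unipotent, that is to say,
have trace 2. -/
theorem mul_comm_of_vecMul_eq_self {M N : Matrix (Fin 2) (Fin 2) ℤ} {k : Fin 2 → ℤ} (hk : k ≠ 0)
    (hM : k ᵥ* M = k) (hN : k ᵥ* N = k) (tM : M.trace = 2) (tN : N.trace = 2) :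
    M * N = N * M := by
  have m0 := congrFun hM 0
  have m1 := congrFun hM 1
  have n0 := congrFun hN 0
  have n1 := congrFun hN 1
  simp only [Matrix.vecMul, dotProduct, Fin.sum_univ_two] at m0 m1 n0 n1
  rw [Matrix.trace_fin_two] at tM tN
  set x := k 0
  set y := k 1
  have hxy : x ≠ 0 ∨ y ≠ 0 := by
    by_contra! h
    apply hk
    ext i
    fin_cases i
    · exact h.1
    · exact h.2
  have em : M 1 1 = 2 - M 0 0 := by linarith
  have en : N 1 1 = 2 - N 0 0 := by linarith
  rw [em] at m1
  rw [en] at n1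
  have h1 : M 0 1 * N 1 0 = N 0 1 * M 1 0 := by
    rcases hxy with h | h
    · apply mul_left_cancel₀ (pow_ne_zero 2 h)
      linear_combination x * N 1 0 * m1 + y * N 1 0 * m0 - x * M 1 0 * n1 - y * M 1 0 * n0
    · apply mul_left_cancel₀ (pow_ne_zero 2 h)
      linear_combination y * M 0 1 * n0 + x * M 0 1 * n1 - y * N 0 1 * m0 - x * N 0 1 * m1
  have h2 : (M 0 0 - 1) * N 0 1 = (N 0 0 - 1) * M 0 1 := by
    rcases hxy with h | h
    · apply mul_left_cancel₀ h
      linear_combination (M 0 0 - 1) * n1 - (N 0 0 - 1) * m1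
    · apply mul_left_cancel₀ h
      linear_combination M 0 1 * n1 - N 0 1 * m1
  have h3 : (M 0 0 - 1) * N 1 0 = (N 0 0 - 1) * M 1 0 := by
    rcases hxy with h | h
    · apply mul_left_cancel₀ h
      linear_combination N 1 0 * m0 - M 1 0 * n0
    · apply mul_left_cancel₀ h
      linear_combination (M 0 0 - 1) * n0 - (N 0 0 - 1) * m0
  ext i j
  fin_cases i <;> fin_cases j <;>
    simp only [Matrix.mul_apply, Fin.sum_univ_two, Fin.zero_eta, Fin.mk_one, em, en]
  · linear_combination h1
  · linear_combination 2 * h2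
  · linear_combination - 2 * h3
  · linear_combination - h1

open Matrix in
/-- A matrix of `GL(2, ℤ)` with a nonzero fixed vector has trace 2 or is an involution. -/
theorem trace_eq_two_or_mul_self_eq_one (A : GL (Fin 2) ℤ) {k : Fin 2 → ℤ} (hk : k ≠ 0)
    (h : k ᵥ* A.val = k) : A.val.trace = 2 ∨ A * A = 1 := by
  have hdet : (A.val - 1).det = 0 := by
    refine Matrix.exists_vecMul_eq_zero_iff.mp ⟨k, hk, ?_⟩
    rw [Matrix.vecMul_sub, h, Matrix.vecMul_one, sub_self]
  have hu : IsUnit A.val.det := (Matrix.isUnit_iff_isUnit_det _).mp A.isUnit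
  rw [Matrix.trace_fin_two]
  rw [Matrix.det_fin_two] at hdet hu
  simp at hdet
  rcases Int.isUnit_iff.mp hu with h1 | h1
  · left
    linarith
  · right
    have htr : A.val 1 1 = - A.val 0 0 := by linarith
    rw [htr] at h1
    ext i j
    fin_cases i <;> fin_cases j <;>
      simp [Matrix.mul_apply, Fin.sum_univ_two, htr] <;> linarith

theorem commute_of_dual_smul_eq {Γ : Subgroup (GL (Fin 2) ℤ)} [IsMulTorsionFree Γ]
    {k : DualLattice} (hk : k ≠ 0) {g h : Γ} (hg : g • k = k) (hh : h • k = k) : g * h = h * g := by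
  have key : ∀ g : Γ, g • k = k → g.val = 1 ∨
      (Matrix.vecMul (k : Fin 2 → ℤ) g.val.val = k ∧ g.val.val.trace = 2) := by
    intro g hg
    have hk' : Matrix.vecMul (k : Fin 2 → ℤ) g.val.val = k := by
      have h1 : g⁻¹ • k = k := by
        rw [inv_smul_eq_iff, hg]
      change Matrix.vecMul (k : Fin 2 → ℤ) ((g⁻¹ : Γ).val⁻¹).val = k at h1
      rwa [Subgroup.coe_inv, inv_inv] at h1
    rcases trace_eq_two_or_mul_self_eq_one g.val hk hk' with h | h
    · exact Or.inr ⟨hk', h⟩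
    · left
      have h2 : g ^ 2 = 1 ^ 2 := by
        rw [one_pow, sq]
        exact Subtype.ext h
      exact congrArg Subtype.val (pow_left_injective two_ne_zero h2)
  apply Subtype.ext
  rcases key g hg with h1 | ⟨h1, h2⟩
  · simp [h1]
  rcases key h hh with h3 | ⟨h3, h4⟩
  · simp [h3]
  apply Units.ext
  exact mul_comm_of_vecMul_eq_self hk h1 h3 h2 h4

/-- A matrix different from `1` fixes at most one vector of the form `(1, t)`, so finitely many such
matrices all move `(1, t)` for some `t`. -/
theorem exists_forall_dual_smul_ne {s : Set (GL (Fin 2) ℤ)} (hs : s.Finite) (h1 : 1 ∉ s) :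
    ∃ k : DualLattice, k ≠ 0 ∧ ∀ A ∈ s, A • k ≠ k := by
  have hfin : (⋃ A ∈ s, {t : ℤ |
      Matrix.vecMul ![1, t] (A⁻¹ : GL (Fin 2) ℤ).val = ![1, t]}).Finite := by
    refine hs.biUnion fun A hA => Set.Subsingleton.finite ?_
    intro t ht u hu
    by_contra hne
    apply h1
    have hA1 : A⁻¹ = 1 := by
      rw [Set.mem_ofPred_eq] at ht hu
      have t0 := congrFun ht 0
      have t1 := congrFun ht 1
      have u0 := congrFun hu 0
      have u1 := congrFun hu 1
      simp only [Matrix.vecMul, dotProduct, Fin.sum_univ_two, Matrix.cons_val_zero,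
        Matrix.cons_val_one, one_mul] at t0 t1 u0 u1
      have hne' : t - u ≠ 0 := sub_ne_zero.mpr hne
      have e10 : (A⁻¹ : GL (Fin 2) ℤ).val 1 0 = 0 := by
        apply (mul_eq_zero.mp _).resolve_left hne'
        linarith
      have e11 : (A⁻¹ : GL (Fin 2) ℤ).val 1 1 - 1 = 0 := by
        apply (mul_eq_zero.mp _).resolve_left hne'
        linarith
      rw [e10, mul_zero, add_zero] at t0
      rw [sub_eq_zero] at e11
      rw [e11, mul_one] at t1
      have e01 : (A⁻¹ : GL (Fin 2) ℤ).val 0 1 = 0 := by linarith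
      apply Units.ext
      ext i j
      fin_cases i <;> fin_cases j
      · simpa using t0
      · simpa using e01
      · simpa using e10
      · simpa using e11
    rw [inv_eq_one] at hA1
    rwa [← hA1]
  obtain ⟨t, ht⟩ := hfin.infinite_compl.nonempty
  refine ⟨(![1, t] : Fin 2 → ℤ), fun h => one_ne_zero (congrFun h 0 : (1 : ℤ) = 0),
    fun A hA hAt => ht ?_⟩
  exact Set.mem_biUnion (s := s) (t := fun A : GL (Fin 2) ℤ => {t : ℤ |
    Matrix.vecMul ![1, t] (A⁻¹ : GL (Fin 2) ℤ).val = ![1, t]}) hA hAt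

/-! ### The Koopman representation on characters -/

/-- The character `x ↦ exp(2πi k·x)` as an element of `L²`. -/
noncomputable def torusChar (k : DualLattice) : Lp ℂ 2 torusHaar :=
  UnitAddTorus.mFourierLp 2 (k : Fin 2 → ℤ)

/-- The Hilbert basis of `L²` formed by the characters. -/
noncomputable def torusCharBasis : HilbertBasis DualLattice ℂ (Lp ℂ 2 torusHaar) :=
  UnitAddTorus.mFourierBasis

theorem torusCharBasis_apply (k : DualLattice) : torusCharBasis k = torusChar k :=
  congrFun UnitAddTorus.coe_mFourierBasis k

theorem orthonormal_torusChar : Orthonormal ℂ torusChar := UnitAddTorus.orthonormal_mFourier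

theorem coeFn_torusChar (k : DualLattice) :
    torusChar k =ᵐ[torusHaar] UnitAddTorus.mFourier k :=
  UnitAddTorus.coeFn_mFourierLp 2 (k : Fin 2 → ℤ)

theorem mFourier_torusAut (k : Fin 2 → ℤ) (A : GL (Fin 2) ℤ) (x : Torus2) :
    UnitAddTorus.mFourier k (torusAut A x) =
      UnitAddTorus.mFourier (Matrix.vecMul (k : Fin 2 → ℤ) A.val) x := by
  simp only [UnitAddTorus.mFourier, ContinuousMap.coe_mk, Fin.prod_univ_two, fourier_apply,
    ← Circle.coe_mul, ← AddCircle.toCircle_add]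
  congr 2
  simp only [torusAut, AddMonoidHom.coe_mk, ZeroHom.coe_mk, Fin.sum_univ_two, Matrix.vecMul,
    dotProduct, smul_add, add_smul, smul_smul]
  abel

theorem coeFn_koopman (A : GL (Fin 2) ℤ) (f : Lp ℂ 2 torusHaar) :
    koopman A f =ᵐ[torusHaar] fun x => f (torusAut A⁻¹ x) :=
  Lp.coeFn_compMeasurePreserving f (measurePreserving_torusAut A⁻¹)

theorem koopman_torusChar (A : GL (Fin 2) ℤ) (k : DualLattice) :
    koopman A (torusChar k) = torusChar (A • k) := by
  apply Lp.ext
  have h := (measurePreserving_torusAut A⁻¹).quasiMeasurePreserving.ae_eq_comp (coeFn_torusChar k)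
  filter_upwards [coeFn_koopman A (torusChar k), h, coeFn_torusChar (A • k)] with x h1 h2 h3
  exact h1.trans ((h2.trans (mFourier_torusAut k A⁻¹ x)).trans h3.symm)

theorem koopman_one (f : Lp ℂ 2 torusHaar) : koopman 1 f = f := by
  apply Lp.ext
  filter_upwards [coeFn_koopman 1 f] with x h1
  rw [h1, inv_one, torusAut_one]

theorem koopman_mul (A B : GL (Fin 2) ℤ) (f : Lp ℂ 2 torusHaar) :
    koopman (A * B) f = koopman A (koopman B f) := by
  apply Lp.ext
  have h := (measurePreserving_torusAut A⁻¹).quasiMeasurePreserving.ae_eq_comp (coeFn_koopman B f)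
  filter_upwards [coeFn_koopman (A * B) f, coeFn_koopman A (koopman B f), h] with x h1 h2 h3
  simp only [Function.comp_apply] at h3
  rw [h1, h2, h3, mul_inv_rev, torusAut_mul]

theorem inner_koopman_koopman (A : GL (Fin 2) ℤ) (f g : Lp ℂ 2 torusHaar) :
    inner ℂ (koopman A f) (koopman A g) = inner ℂ f g :=
  LinearIsometry.inner_map_map _ f g

theorem inner_koopman_left (A : GL (Fin 2) ℤ) (f g : Lp ℂ 2 torusHaar) :
    inner ℂ (koopman A f) g = inner ℂ f (koopman A⁻¹ g) := by
  rw [← inner_koopman_koopman A f, ← koopman_mul, mul_inv_cancel, koopman_one]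

theorem inner_torusChar_koopman (A : GL (Fin 2) ℤ) (f : Lp ℂ 2 torusHaar) (k : DualLattice) :
    inner ℂ (torusChar k) (koopman A f) = inner ℂ (torusChar (A⁻¹ • k)) f := by
  rw [← koopman_torusChar, inner_koopman_left, inv_inv]

theorem inner_torusChar_zero (f : Lp ℂ 2 torusHaar) :
    inner ℂ (torusChar 0) f = ∫ x, f x ∂torusHaar := by
  rw [L2.inner_def]
  apply integral_congr_ae
  filter_upwards [coeFn_torusChar 0] with x hx
  have h1 : torusChar 0 x = 1 :=
    hx.trans (DFunLike.congr_fun (UnitAddTorus.mFourier_zero (d := Fin 2)) x)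
  rw [h1]
  simp

theorem mem_torusL20 {f : Lp ℂ 2 torusHaar} : f ∈ torusL20 ↔ inner ℂ (torusChar 0) f = 0 := by
  rw [inner_torusChar_zero]
  rfl

theorem torusChar_mem {k : DualLattice} (hk : k ≠ 0) : torusChar k ∈ torusL20 :=
  mem_torusL20.mpr (orthonormal_torusChar.2 hk.symm)

instance : CompleteSpace torusL20 := by
  have h : (torusL20 : Set (Lp ℂ 2 torusHaar)) = (innerSL ℂ (torusChar 0)) ⁻¹' {0} := by
    ext f
    exact mem_torusL20
  have hcl : IsClosed (torusL20 : Set (Lp ℂ 2 torusHaar)) := by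
    rw [h]
    exact isClosed_singleton.preimage (innerSL ℂ (torusChar 0)).continuous
  exact hcl.completeSpace_coe

theorem hasSum_sq_norm_inner_torusChar (f : Lp ℂ 2 torusHaar) :
    HasSum (fun k => ‖inner ℂ (torusChar k) f‖ ^ 2) (‖f‖ ^ 2) := by
  have h := lp.hasSum_norm (p := 2) (by norm_num) (torusCharBasis.repr f)
  rw [LinearIsometryEquiv.norm_map] at h
  simpa [HilbertBasis.repr_apply_apply, torusCharBasis_apply] using h

/-- The Koopman representation on `L²₀` as a homomorphism. -/
noncomputable def koopmanZeroHom : GL (Fin 2) ℤ →* (torusL20 →L[ℂ] torusL20) where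
  toFun := koopmanZero
  map_one' := by
    ext1 f
    exact Subtype.ext (koopman_one f)
  map_mul' A B := by
    ext1 f
    exact Subtype.ext (koopman_mul A B f)

/-! ### The sphere operators on `L²₀` -/

section SphereOperators

open FreeGroupBasis

variable {r : ℕ} {Γ : Subgroup (GL (Fin 2) ℤ)} (a : FreeGroupBasis (Fin r) Γ)

/-- The sum of the operators `π₀(γ)` over the sphere of radius `n`. -/
noncomputable def sphereOp (n : ℕ) : torusL20 →L[ℂ] torusL20 :=
  ∑ γ ∈ a.sphere n, koopmanZero (γ : GL (Fin 2) ℤ)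

theorem sphereOp_coe (n : ℕ) (f : torusL20) :
    (sphereOp a n f : Lp ℂ 2 torusHaar) = ∑ γ ∈ a.sphere n, koopman (γ : GL (Fin 2) ℤ) f := by
  simp only [sphereOp, sum_apply, Submodule.coe_sum]
  rfl

theorem isSphereSequence_sphereOp {d : ℕ} (hd : 2 * r = d + 1) :
    IsSphereSequence (d : ℝ) (sphereOp a) :=
  isSphereSequence (by simp; omega) (koopmanZeroHom.comp Γ.subtype)

theorem isSelfAdjoint_sphereOp (n : ℕ) : IsSelfAdjoint (sphereOp a n) := by
  rw [ContinuousLinearMap.isSelfAdjoint_iff_isSymmetric]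
  intro f g
  change inner ℂ (sphereOp a n f : Lp ℂ 2 torusHaar) g = inner ℂ (f : Lp ℂ 2 torusHaar)
    (sphereOp a n g : Lp ℂ 2 torusHaar)
  rw [sphereOp_coe, sphereOp_coe, sum_inner, inner_sum]
  refine Finset.sum_equiv (Equiv.inv Γ) (fun γ => by simp) fun γ _ => ?_
  exact inner_koopman_left _ _ _

/-- The Schur test for the orientation of the orbits of `Γ` in `ℤ² \ {0}`, which is applied to the
absolute values of the Fourier coefficients. -/
theorem norm_sphereOp_one_le {q : ℝ} (hq : 1 ≤ q) (hr : 2 * (r : ℝ) = q + 1) :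
    ‖sphereOp a 1‖ ≤ 2 * √q := by
  have : IsMulTorsionFree Γ := a.repr.injective.isMulTorsionFree a.repr.toMonoidHom
  refine ContinuousLinearMap.opNorm_le_bound _ (by positivity) fun f => ?_
  obtain ⟨σ, hσ⟩ := a.exists_orientation {k : DualLattice | k ≠ 0}
    (fun g k hk => dual_smul_ne_zero (g : GL (Fin 2) ℤ) hk)
    (fun k hk g h hg hh => commute_of_dual_smul_eq hk hg hh)
  have h0 : inner ℂ (torusChar 0) (f : Lp ℂ 2 torusHaar) = 0 := mem_torusL20.mp f.2
  have key := schur_test (a := a) hq (by simp; linarith) σ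
    (b := fun k => ‖inner ℂ (torusChar k) (sphereOp a 1 f : Lp ℂ 2 torusHaar)‖)
    (c := fun k => ‖inner ℂ (torusChar k) (f : Lp ℂ 2 torusHaar)‖)
    (fun k hk => hσ k (by
      rintro rfl
      simp [h0] at hk))
    (hasSum_sq_norm_inner_torusChar _) (hasSum_sq_norm_inner_torusChar _) (fun k => by
      rw [sphereOp_coe, sum_sphere_one, inner_sum, abs_norm]
      refine (norm_sum_le _ _).trans (le_of_eq ?_)
      refine Finset.sum_congr rfl fun s _ => ?_
      rw [inner_torusChar_koopman]
      rfl)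
  rw [← mul_pow] at key
  exact le_of_sq_le_sq key (by positivity)

/-- A character whose translates by the ball of radius `N` are distinct behaves like the indicator
function of a vertex of the tree. -/
theorem exists_test_vector {d : ℕ} (hd : 2 * r = d + 1) (N : ℕ) : ∃ e : torusL20,
    (∀ j ≤ N, ∀ k ≤ N, j ≠ k → inner ℂ (sphereOp a j e) (sphereOp a k e) = 0) ∧ ‖e‖ = 1 ∧
      ∀ k < N, ‖sphereOp a (k + 1) e‖ ^ 2 = ((d : ℝ) + 1) * (d : ℝ) ^ k := by
  have hfin : (Subtype.val '' {g : Γ | a.len g ≤ 2 * N ∧ g ≠ 1}).Finite :=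
    ((finite_len_le (a := a) (2 * N)).subset fun g hg => hg.1).image _
  obtain ⟨v, hv, hfix⟩ := exists_forall_dual_smul_ne hfin (by
    rintro ⟨g, hg, hg1⟩
    exact hg.2 (Subtype.ext hg1))
  have hinj : ∀ g h : Γ, a.len g ≤ N → a.len h ≤ N → g ≠ h →
      (g : GL (Fin 2) ℤ) • v ≠ (h : GL (Fin 2) ℤ) • v := by
    intro g h hg hh hne heq
    refine hfix (h⁻¹ * g : Γ) ⟨h⁻¹ * g, ⟨?_, ?_⟩, rfl⟩ ?_
    · refine (a.len_mul_le _ _).trans ?_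
      rw [len_inv]
      omega
    · rw [Ne, inv_mul_eq_one]
      exact hne.symm
    · rw [Subgroup.coe_mul, Subgroup.coe_inv, mul_smul, heq, inv_smul_smul]
  let e : torusL20 := ⟨torusChar v, torusChar_mem hv⟩
  have hA : ∀ k, (sphereOp a k e : Lp ℂ 2 torusHaar) =
      ∑ g ∈ a.sphere k, torusChar ((g : GL (Fin 2) ℤ) • v) := fun k => by
    rw [sphereOp_coe]
    exact Finset.sum_congr rfl fun g _ => koopman_torusChar _ _
  refine ⟨e, fun j hj k hk hjk => ?_, orthonormal_torusChar.1 v, fun k hk => ?_⟩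
  · rw [Submodule.coe_inner, hA, hA, sum_inner]
    refine Finset.sum_eq_zero fun g hg => ?_
    rw [inner_sum]
    refine Finset.sum_eq_zero fun h hh => orthonormal_torusChar.2 ?_
    rw [mem_sphere] at hg hh
    refine hinj g h (by omega) (by omega) ?_
    rintro rfl
    omega
  · rw [Submodule.coe_norm, hA, norm_sum_sq_of_orthogonal]
    · rw [Finset.sum_congr rfl fun g _ => by rw [orthonormal_torusChar.1, one_pow],
        Finset.sum_const, card_sphere_succ (q := d) (by simp; omega)]
      simp
    · intro g hg h hh hne
      rw [mem_sphere] at hg hh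
      exact orthonormal_torusChar.2 (hinj g h (by omega) (by omega) hne)

/-- The norm of a sum of sphere operators is the value of the corresponding polynomial at `2 √d`,
the spectral radius of the `(d+1)`-regular tree. -/
theorem norm_sum_sphereOp {d : ℕ} (hd : 2 * r = d + 1) (hd1 : 1 ≤ d) (I : Finset ℕ) :
    ‖∑ k ∈ I, sphereOp a k‖ = ∑ k ∈ I, (spherePoly d k).eval (2 * √d) := by
  have hq : (1 : ℝ) ≤ d := by exact_mod_cast hd1
  exact (isSphereSequence_sphereOp a hd).norm_sum_eq hq (isSelfAdjoint_sphereOp a 1)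
    (norm_sphereOp_one_le a hq (by exact_mod_cast hd)) (exists_test_vector a hd) I

end SphereOperators

/-! ### The mean ergodic error -/

section MeanErgodicError

variable {Γ : Subgroup (GL (Fin 2) ℤ)}

/-- The projection of `L²` onto `L²₀` is a contraction. -/
theorem norm_sub_proj_le (f : Lp ℂ 2 torusHaar) :
    ‖f - inner ℂ (torusChar 0) f • torusChar 0‖ ≤ ‖f‖ := by
  set c := inner ℂ (torusChar 0) f with hc
  set g := f - c • torusChar 0 with hg
  have horth : inner ℂ (c • torusChar 0) g = 0 := by
    have h1 : inner ℂ (torusChar 0) (torusChar 0) = (1 : ℂ) := by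
      rw [inner_self_eq_norm_sq_to_K, orthonormal_torusChar.1]
      simp
    rw [inner_smul_left, hg, inner_sub_right, inner_smul_right, h1, ← hc]
    simp
  have hsum : c • torusChar 0 + g = f := by rw [hg]; abel
  have h2 := norm_add_sq_eq_norm_sq_add_norm_sq_of_inner_eq_zero _ _ horth
  rw [hsum] at h2
  nlinarith [norm_nonneg f, norm_nonneg g, mul_self_nonneg ‖c • torusChar 0‖]

theorem koopman_torusChar_zero (A : GL (Fin 2) ℤ) : koopman A (torusChar 0) = torusChar 0 := by
  rw [koopman_torusChar, dual_smul_zero]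

/-- The averaging operator of `E` on `L²₀`. -/
noncomputable def averageOp (E : Finset Γ) : torusL20 →L[ℂ] torusL20 :=
  (E.card : ℂ)⁻¹ • ∑ γ ∈ E, koopmanZero (γ : GL (Fin 2) ℤ)

theorem averageOp_coe (E : Finset Γ) (f : torusL20) : (averageOp E f : Lp ℂ 2 torusHaar) =
    (E.card : ℂ)⁻¹ • ∑ γ ∈ E, koopman (γ : GL (Fin 2) ℤ) f := by
  simp only [averageOp, smul_apply, sum_apply, Submodule.coe_smul, Submodule.coe_sum]
  rfl

/-- The mean of `f` along a symmetric set minus the integral of `f` is the averaging operator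
applied to the projection `g` of `f` to `L²₀`. -/
theorem eLpNorm_mean_sub_integral {E : Finset Γ} (hE : ∀ γ ∈ E, γ⁻¹ ∈ E) (hne : E.Nonempty)
    {f : Torus2 → ℂ} (hf : MemLp f 2 torusHaar) (g : torusL20)
    (hg : (g : Lp ℂ 2 torusHaar) =
      hf.toLp f - inner ℂ (torusChar 0) (hf.toLp f) • torusChar 0) :
    eLpNorm (fun x => (E.card : ℂ)⁻¹ * ∑ γ ∈ E, f (torusAut (γ : GL (Fin 2) ℤ) x)
      - ∫ y, f y ∂torusHaar) 2 torusHaar = ENNReal.ofReal ‖averageOp E g‖ := by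
  have hcard : (E.card : ℂ) ≠ 0 := Nat.cast_ne_zero.mpr hne.card_pos.ne'
  have hint : inner ℂ (torusChar 0) (hf.toLp f) = ∫ y, f y ∂torusHaar := by
    rw [inner_torusChar_zero]
    exact integral_congr_ae hf.coeFn_toLp
  -- the mean is `π(μ_E) f`, since `E` is symmetric, and `π(μ_E)` fixes the constants
  have hop : (averageOp E g : Lp ℂ 2 torusHaar) =
      (E.card : ℂ)⁻¹ • ∑ γ ∈ E, koopman ((γ : GL (Fin 2) ℤ)⁻¹) (hf.toLp f) -
        (∫ y, f y ∂torusHaar) • torusChar 0 := by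
    have hinv : ∑ γ ∈ E, koopman ((γ : GL (Fin 2) ℤ)⁻¹) (hf.toLp f) =
        ∑ γ ∈ E, koopman (γ : GL (Fin 2) ℤ) (hf.toLp f) :=
      Finset.sum_equiv (Equiv.inv Γ)
        (fun γ => ⟨hE γ, fun h => by simpa using hE _ h⟩) fun γ _ => rfl
    rw [averageOp_coe, hg, hint, hinv]
    simp only [map_sub, map_smul, koopman_torusChar_zero, Finset.sum_sub_distrib,
      Finset.sum_const, smul_sub]
    rw [← Nat.cast_smul_eq_nsmul ℂ, inv_smul_smul₀ hcard]
  have hae : (averageOp E g : Lp ℂ 2 torusHaar) =ᵐ[torusHaar]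
      fun x => (E.card : ℂ)⁻¹ * ∑ γ ∈ E, f (torusAut (γ : GL (Fin 2) ℤ) x)
        - ∫ y, f y ∂torusHaar := by
    rw [hop]
    have h1 : ∀ γ ∈ E, koopman ((γ : GL (Fin 2) ℤ)⁻¹) (hf.toLp f) =ᵐ[torusHaar]
        fun x => f (torusAut (γ : GL (Fin 2) ℤ) x) := by
      intro γ _
      have h2 := (measurePreserving_torusAut (γ : GL (Fin 2) ℤ)).quasiMeasurePreserving.ae_eq_comp
        hf.coeFn_toLp
      have h3 := coeFn_koopman (γ : GL (Fin 2) ℤ)⁻¹ (hf.toLp f)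
      rw [inv_inv] at h3
      exact h3.trans h2
    have h4 := (Filter.eventually_all_finset E).mpr h1
    filter_upwards [h4, Lp.coeFn_sub ((E.card : ℂ)⁻¹ •
        ∑ γ ∈ E, koopman ((γ : GL (Fin 2) ℤ)⁻¹) (hf.toLp f))
        ((∫ y, f y ∂torusHaar) • torusChar 0),
      Lp.coeFn_smul (E.card : ℂ)⁻¹ (∑ γ ∈ E, koopman ((γ : GL (Fin 2) ℤ)⁻¹) (hf.toLp f)),
      Lp.coeFn_smul (∫ y, f y ∂torusHaar) (torusChar 0), coeFn_torusChar 0,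
      Lp.coeFn_finsetSum E fun γ => koopman ((γ : GL (Fin 2) ℤ)⁻¹) (hf.toLp f)]
      with x x1 x2 x3 x4 x5 x6
    have x7 : torusChar 0 x = 1 :=
      x5.trans (DFunLike.congr_fun (UnitAddTorus.mFourier_zero (d := Fin 2)) x)
    rw [x2, Pi.sub_apply, x3, x4, Pi.smul_apply, Pi.smul_apply, x6, x7, Finset.sum_apply,
      Finset.sum_congr rfl x1]
    simp
  rw [← eLpNorm_congr_ae hae, Submodule.coe_norm, Lp.norm_def,
    ENNReal.ofReal_toReal (Lp.eLpNorm_ne_top _)]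

/-- For a symmetric set, the mean ergodic error and the discrepancy are the same number: both are
the norm of the averaging operator on `L²₀`, since the projection onto `L²₀` is a contraction. -/
theorem meanErgodicError_eq_discrepancy {E : Finset Γ} (hE : ∀ γ ∈ E, γ⁻¹ ∈ E)
    (hne : E.Nonempty) : meanErgodicError E = ENNReal.ofReal (discrepancy E) := by
  change _ = ENNReal.ofReal ‖averageOp E‖
  apply le_antisymm
  · refine iSup_le fun f => iSup_le fun hf => iSup_le fun hf1 => ?_
    let g : torusL20 := ⟨hf.toLp f - inner ℂ (torusChar 0) (hf.toLp f) • torusChar 0, by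
      rw [mem_torusL20, inner_sub_right, inner_smul_right, inner_self_eq_norm_sq_to_K,
        orthonormal_torusChar.1]
      simp⟩
    rw [eLpNorm_mean_sub_integral hE hne hf g rfl]
    refine ENNReal.ofReal_le_ofReal (((averageOp E).le_opNorm g).trans ?_)
    refine mul_le_of_le_one_right (averageOp E).opNorm_nonneg ?_
    refine (norm_sub_proj_le (hf.toLp f)).trans (le_of_eq ?_)
    rw [Lp.norm_toLp, hf1, ENNReal.toReal_one]
  · by_cases htop : meanErgodicError E = ⊤
    · simp [htop]
    rw [ENNReal.ofReal_le_iff_le_toReal htop]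
    refine ContinuousLinearMap.opNorm_le_of_unit_norm ENNReal.toReal_nonneg fun g hg => ?_
    rw [← ENNReal.ofReal_le_iff_le_toReal htop]
    have hmem := Lp.memLp (g : Lp ℂ 2 torusHaar)
    rw [← eLpNorm_mean_sub_integral hE hne hmem g (by
      rw [Lp.toLp_coeFn, mem_torusL20.mp g.2, zero_smul, sub_zero])]
    refine le_iSup_of_le _ (le_iSup_of_le hmem (le_iSup_of_le ?_ le_rfl))
    have := Lp.enorm_def (g : Lp ℂ 2 torusHaar)
    rw [← this, ← ofReal_norm, ← Submodule.coe_norm, hg, ENNReal.ofReal_one]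

end MeanErgodicError

/-! ### Explicit values -/

open FreeGroupBasis

theorem rpow_neg_half {q : ℝ} (hq : 0 ≤ q) (n : ℕ) : q ^ (-(n : ℝ) / 2) = (√q ^ n)⁻¹ := by
  rw [neg_div, Real.rpow_neg hq, Real.rpow_div_two_eq_sqrt _ hq, Real.rpow_natCast]

section

variable {r : ℕ} {Γ : Subgroup (GL (Fin 2) ℤ)} (a : FreeGroupBasis (Fin r) Γ) {d : ℕ}

theorem card_sphere_mul_eq (hd : 2 * r = d + 1) (hd1 : 1 ≤ d) (n : ℕ) :
    ((a.sphere n).card : ℝ)⁻¹ * (spherePoly d n).eval (2 * √d) =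
      (1 + ((d : ℝ) - 1) / (d + 1) * n) * (d : ℝ) ^ (-(n : ℝ) / 2) := by
  have hq : (1 : ℝ) ≤ d := by exact_mod_cast hd1
  have hs0 : 0 < √(d : ℝ) := Real.sqrt_pos.mpr (by linarith)
  rw [rpow_neg_half (by positivity)]
  cases n with
  | zero => simp [sphere_zero, spherePoly]
  | succ n =>
    have hss : (d : ℝ) ^ n * d = √d ^ (n + 1) * √d ^ (n + 1) := by
      rw [← pow_succ, ← mul_pow, Real.mul_self_sqrt (by positivity)]
    rw [card_sphere_succ (q := d) (by simp; omega), eval_spherePoly_succ_two_sqrt hq]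
    have h1 : ((1 - 1 / (d : ℝ)) * (n + 2) + 2 / d) = ((d - 1) * (n + 2) + 2) / d := by
      field_simp
    rw [h1]
    push_cast
    field_simp
    rw [mul_comm] at hss
    linear_combination (-((d : ℝ) - 1) * (n + 2) - 2) * hss

theorem sum_eval_spherePoly {q : ℝ} (hq : 1 ≤ q) (n : ℕ) :
    ∑ k ∈ Finset.range (n + 1), (spherePoly q k).eval (2 * √q) =
      √q ^ n * (1 + (1 + 1 / √q) * n) := by
  have hs0 : 0 < √q := Real.sqrt_pos.mpr (by linarith)
  induction n with
  | zero => simp [spherePoly]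
  | succ n ih =>
    rw [Finset.sum_range_succ, ih, eval_spherePoly_succ_two_sqrt hq]
    have hss : q = √q ^ 2 := (Real.sq_sqrt (by linarith)).symm
    have h1 : 1 / q = (1 / √q) ^ 2 := by rw [div_pow, one_pow, ← hss]
    have h2 : 2 / q = 2 * (1 / √q) ^ 2 := by rw [← h1]; ring
    rw [h1, h2]
    push_cast
    field_simp
    ring

theorem sum_card_sphere (hd : 2 * r = d + 1) (n : ℕ) :
    ∑ k ∈ Finset.range (n + 1), ((a.sphere k).card : ℝ) =
      (d : ℝ) ^ n + 2 * ∑ k ∈ Finset.range n, (d : ℝ) ^ k := by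
  induction n with
  | zero => simp [sphere_zero]
  | succ n ih =>
    rw [Finset.sum_range_succ, ih, card_sphere_succ (q := d) (by simp; omega),
      Finset.sum_range_succ _ n]
    push_cast
    ring

theorem card_ball_mul_eq (hd : 2 * r = d + 1) (hd1 : 1 ≤ d) (n : ℕ) :
    (∑ k ∈ Finset.range (n + 1), ((a.sphere k).card : ℝ))⁻¹ *
        ∑ k ∈ Finset.range (n + 1), (spherePoly d k).eval (2 * √d) =
      ballConstant d n * (1 + (1 + 1 / √d) * n) * (d : ℝ) ^ (-(n : ℝ) / 2) := by
  have hq : (1 : ℝ) ≤ d := by exact_mod_cast hd1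
  have hs0 : 0 < √(d : ℝ) := Real.sqrt_pos.mpr (by linarith)
  rw [rpow_neg_half (by positivity), sum_card_sphere a hd, sum_eval_spherePoly hq, ballConstant]
  set S := ∑ k ∈ Finset.range n, (d : ℝ) ^ k with hS
  have hS0 : 0 ≤ S := Finset.sum_nonneg fun k _ => by positivity
  have hss : (d : ℝ) ^ n = √d ^ n * √d ^ n := by
    rw [← mul_pow, Real.mul_self_sqrt (by positivity)]
  have hp : 0 < √(d : ℝ) ^ n := by positivity
  rw [hss]
  field_simp

theorem norm_inv_natCast_smul {E : Type*} [NormedAddCommGroup E] [NormedSpace ℂ E] (n : ℕ)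
    (T : E →L[ℂ] E) : ‖(n : ℂ)⁻¹ • T‖ = (n : ℝ)⁻¹ * ‖T‖ := by
  rw [norm_smul, norm_inv, Complex.norm_natCast]

open scoped Classical in
theorem discrepancy_biUnion_sphere (hd : 2 * r = d + 1) (hd1 : 1 ≤ d) (I : Finset ℕ) :
    discrepancy (I.biUnion a.sphere) = (∑ k ∈ I, ((a.sphere k).card : ℝ))⁻¹ *
      ∑ k ∈ I, (spherePoly d k).eval (2 * √d) := by
  have hdisj : (I : Set ℕ).PairwiseDisjoint a.sphere := by
    intro j _ k _ hjk
    refine Finset.disjoint_left.mpr fun g hj hk => hjk ?_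
    rw [mem_sphere] at hj hk
    rw [← hj, ← hk]
  rw [discrepancy, Finset.sum_biUnion hdisj, Finset.card_biUnion hdisj,
    ← norm_sum_sphereOp a hd hd1]
  refine (norm_inv_natCast_smul _ _).trans ?_
  rw [Nat.cast_sum]
  rfl

open scoped Classical in
theorem meanErgodicError_biUnion_sphere {I : Finset ℕ} (hr : 1 ≤ r) (hI : I.Nonempty) :
    meanErgodicError (I.biUnion a.sphere) =
      ENNReal.ofReal (discrepancy (I.biUnion a.sphere)) := by
  refine meanErgodicError_eq_discrepancy (fun γ h => by simpa using h) ?_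
  obtain ⟨k, hk⟩ := hI
  refine Finset.Nonempty.mono (Finset.subset_biUnion_of_mem a.sphere hk) ?_
  rw [← Finset.card_pos]
  cases k with
  | zero => simp [sphere_zero]
  | succ k =>
    rw [card_sphere_succ (q := 2 * r - 1) (by simp; omega)]
    have : 0 < 2 * r - 1 := by omega
    positivity

end

theorem mainTheorem2 (r : ℕ) (hr : 1 ≤ r) (Γ : Subgroup (GL (Fin 2) ℤ))
    (a : FreeGroupBasis (Fin r) Γ) (q : ℝ) (hq : q = 2 * (r : ℝ) - 1) (n : ℕ) :
    (discrepancy (wordSphere (symmGenerators a) n)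
        = (1 + (q - 1) / (q + 1) * n) * q ^ (-(n : ℝ) / 2) ∧
      meanErgodicError (wordSphere (symmGenerators a) n)
        = ENNReal.ofReal ((1 + (q - 1) / (q + 1) * n) * q ^ (-(n : ℝ) / 2))) ∧
    (discrepancy (wordBall (symmGenerators a) n)
        = ballConstant q n * (1 + (1 + 1 / √q) * n) * q ^ (-(n : ℝ) / 2) ∧
      meanErgodicError (wordBall (symmGenerators a) n)
        = ENNReal.ofReal
            (ballConstant q n * (1 + (1 + 1 / √q) * n) * q ^ (-(n : ℝ) / 2))) := by
  classical
  obtain ⟨d, hd⟩ : ∃ d, 2 * r = d + 1 := ⟨2 * r - 1, by omega⟩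
  have hd1 : 1 ≤ d := by omega
  have hqd : q = d := by
    have : (2 * r : ℝ) = d + 1 := by exact_mod_cast hd
    rw [hq, this, add_sub_cancel_right]
  subst hqd
  have hsphere : wordSphere (symmGenerators a) n = ({n} : Finset ℕ).biUnion a.sphere := by
    rw [wordSphere_eq_sphere, Finset.singleton_biUnion]
  have h1 := discrepancy_biUnion_sphere a hd hd1 {n}
  rw [Finset.sum_singleton, Finset.sum_singleton, card_sphere_mul_eq a hd hd1] at h1
  have h2 := discrepancy_biUnion_sphere a hd hd1 (Finset.range (n + 1))
  rw [card_ball_mul_eq a hd hd1] at h2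
  rw [hsphere, wordBall_eq_biUnion, meanErgodicError_biUnion_sphere a hr (by simp),
    meanErgodicError_biUnion_sphere a hr (by simp), h1, h2]
  exact ⟨⟨rfl, rfl⟩, rfl, rfl⟩
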